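/- \textbf{Setting.} Let $(M,g)$ and $(N,h)$ be smooth (Hausdorff, finite-dimensional) manifolds of dimensions $m$, $n$ with semi-Riemannian metrics, i.e. smooth symmetric $2$-tensors, of constant signatures $(r,p,q)$ and $(\rho,p',q')$; here $(r,p,q)$ means that each tangent space has a basis in which the form is $\operatorname{diag}(0,\dots,0,-1,\dots,-1,1,\dots,1)$ with $r$ zeros, $p$ entries $-1$ and $q$ entries $+1$, so degenerate metrics are allowed. Let $\mathcal N(T_xM)=\{u\in T_xM: g(u,v)=0\ \forall v\in T_xM\}$ be the radical, $\overline{T_xM}=T_xM/\mathcal N(T_xM)$, and let $\bar g$ be the non-degenerate form induced by $g$ on $\overline{T_xM}$; similarly for $N$. Assume that $M$ and $N$ are \emph{stationary}: $\mathcal L_Ag=0$ for every locally defined smooth section $A$ of $\mathcal N(TM)$, and likewise for $h$. Let $\bar\nabla_X\bar Y=\overline{D_XY}$ be the Koszul connection on $\overline{TM}$, where $D_XY$ is determined modulo the radical by the Koszul formula $$2g(D_XY,Z)=Xg(Y,Z)+Yg(Z,X)-Zg(X,Y)-g(X,[Y,Z])+g(Y,[Z,X])+g(Z,[X,Y]).$$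 Let $\phi:M\to N$ be a $C^2$ map that is \emph{radical-preserving}, $d\phi_x(\mathcal N(T_xM))\subseteq\mathcal N(T_{\phi(x)}N)$ for all $x$, and let $\overline{d\phi}_x:\overline{T_xM}\to\overline{T_{\phi(x)}N}$ be the induced map. Its generalized tension field is $$\bar\tau(\phi)_x=\operatorname{tr}_{\bar g}\overline B^{\phi}\in\overline{T_{\phi(x)}N},\qquad \overline B^\phi(\bar X,\bar Y)=\bar\nabla_X(\overline{d\phi}\,\bar Y)-\overline{d\phi}(\bar\nabla_X\bar Y)$$ (with the pull-back of the Koszul connection of $N$ in the first term), and $\phi$ is called generalized harmonic if $\bar\tau(\phi)\equiv0$. Assume finally that the radical foliations (the foliations tangent to the radical distributions) are simple: the leaf spaces $\overline M$ and $\overline N$, with the quotient topology, carry structures of smooth Hausdorff manifolds, of dimensions $m-r=p+q$ and $n-\rho=p'+q'$, such that the projections $\pi_M:M\to\overline M$ and $\pi_N:N\to\overline N$ are smooth submersions. Let $\overline\phi:\overline M\to\overline N$, $[x]\mapsto[\phi(x)]$, be the induced map. \textbf{Proposition.} The differentials of $\pi_M$ and $\pi_N$ induce isomorphisms $\Psi^M_x:\overline{T_xM}\to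 T_{[x]}\overline M$ and $\Psi^N_y:\overline{T_yN}\to T_{[y]}\overline N$ for all $x\in M$ and $y\in N$. The forms $\bar g$, $\bar h$ are carried by these isomorphisms to well-defined smooth non-degenerate metrics $g^{\overline M}$, $h^{\overline N}$ of signatures $(0,p,q)$, $(0,p',q')$ on $\overline M$, $\overline N$. The map $\overline\phi$ is well defined and $C^2$, and for every $x\in M$ $$\Psi^N_{\phi(x)}\big(\bar\tau(\phi)_x\big)=\tau(\overline\phi)_{[x]},$$ where $\tau(\overline\phi)=\operatorname{tr}_{g^{\overline M}}\nabla d\overline\phi$ is the ordinary tension field of $\overline\phi:(\overline M,g^{\overline M})\to(\overline N,h^{\overline N})$ with respect to the Levi-Civita connections. In particular, $\overline\phi$ is harmonic (that is, $\tau(\overline\phi)\equiv0$) if and only if $\phi$ is generalized harmonic. -/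

import Mathlib

open Set Function
open scoped Manifold ContDiff Topology

noncomputable section

/-- The model space `ℝ^m`. -/
abbrev Eucl (m : ℕ) : Type := EuclideanSpace ℝ (Fin m)

/-- The tangent space at `x` of a manifold modelled on `ℝ^m` (without boundary). -/
abbrev TSp (m : ℕ) {M : Type*} [TopologicalSpace M] [ChartedSpace (Eucl m) M] (x : M) : Type :=
  TangentSpace 𝓘(ℝ, Eucl m) x

/-- A (not necessarily continuous) vector field on `M`. -/
abbrev VField (m : ℕ) (M : Type*) [TopologicalSpace M] [ChartedSpace (Eucl m) M] : Type _ :=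
  Π x : M, TSp m x

instance {m : ℕ} {M : Type*} [TopologicalSpace M] [ChartedSpace (Eucl m) M] (x : M) :
    FiniteDimensional ℝ (TSp m x) :=
  inferInstanceAs (FiniteDimensional ℝ (Eucl m))

/-- The vector field `X` is smooth on the set `U`. -/
def SmoothFieldOn {m : ℕ} {M : Type*} [TopologicalSpace M] [ChartedSpace (Eucl m) M]
    [IsManifold 𝓘(ℝ, Eucl m) ∞ M] (X : VField m M) (U : Set M) : Prop :=
  ContMDiffOn 𝓘(ℝ, Eucl m) 𝓘(ℝ, Eucl m).tangent ∞
    (fun x => (⟨x, X x⟩ : TangentBundle 𝓘(ℝ, Eucl m) M)) U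

/-- The derivative `X f` of a function `f` along a vector field `X`. -/
def fieldDeriv {m : ℕ} {M : Type*} [TopologicalSpace M] [ChartedSpace (Eucl m) M]
    (X : VField m M) (f : M → ℝ) (x : M) : ℝ :=
  mvfderiv 𝓘(ℝ, Eucl m) f x (X x)

/-- The Lie bracket `[X, Y]` of vector fields. -/
def fieldBracket {m : ℕ} {M : Type*} [TopologicalSpace M] [ChartedSpace (Eucl m) M]
    (X Y : VField m M) : VField m M :=
  VectorField.mlieBracket 𝓘(ℝ, Eucl m) X Y

/-! ### Symmetric 2-tensors, their radical, semi-Riemannian metrics -/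

/-- A field of symmetric bilinear forms on the tangent spaces of `M`; regularity and signature are
imposed by `IsSemiRiemannian`. -/
structure SymTensor (m : ℕ) (M : Type*) [TopologicalSpace M] [ChartedSpace (Eucl m) M] where
  form : ∀ x : M, LinearMap.BilinForm ℝ (TSp m x)
  symm : ∀ (x : M) (u v : TSp m x), form x u v = form x v u

section SymTensor

variable {m : ℕ} {M : Type*} [TopologicalSpace M] [ChartedSpace (Eucl m) M]

/-- The function `g(X, Y)` for vector fields `X`, `Y`. -/
def SymTensor.pair (g : SymTensor m M) (X Y : VField m M) (x : M) : ℝ :=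
  g.form x (X x) (Y x)

/-- The radical `𝒩(T_x M) = {u | g(u, v) = 0 for all v}`. -/
def SymTensor.radical (g : SymTensor m M) (x : M) : Submodule ℝ (TSp m x) where
  carrier := {u | ∀ v, g.form x u v = 0}
  add_mem' := by
    intro a b ha hb v
    rw [map_add, LinearMap.add_apply, ha v, hb v, add_zero]
  zero_mem' := by
    intro v
    simp
  smul_mem' := by
    intro c a ha v
    rw [map_smul, LinearMap.smul_apply, ha v, smul_zero]

/-- The fibre `T_x M / 𝒩(T_x M)` of the quotient tangent bundle. -/
abbrev SymTensor.QT (g : SymTensor m M) (x : M) : Type := TSp m x ⧸ g.radical x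

/-- The class of a tangent vector in the quotient tangent space. -/
abbrev SymTensor.cls (g : SymTensor m M) (x : M) : TSp m x →ₗ[ℝ] g.QT x := (g.radical x).mkQ

/-- The form `ḡ(X̄, Ȳ) = g(X, Y)` on the quotient tangent space. -/
def SymTensor.barForm (g : SymTensor m M) (x : M) : LinearMap.BilinForm ℝ (g.QT x) :=
  (g.radical x).liftQ
    { toFun := fun u => (g.radical x).liftQ (g.form x u)
        (fun v hv => by
          rw [LinearMap.mem_ker, g.symm]
          exact hv u)
      map_add' := by
        intro a b
        ext v
        simp
      map_smul' := by
        intro c a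
        ext v
        simp }
    (fun u hu => by
      rw [LinearMap.mem_ker]
      ext v
      exact hu v)

theorem SymTensor.barForm_cls (g : SymTensor m M) (x : M) (u v : TSp m x) :
    g.barForm x (g.cls x u) (g.cls x v) = g.form x u v := rfl

/-- A representative in `T_x M` of a class in `T_x M / 𝒩(T_x M)`. -/
def SymTensor.rep (g : SymTensor m M) (x : M) (ξ : g.QT x) : TSp m x :=
  surjInv (g.radical x).mkQ_surjective ξ

theorem SymTensor.cls_rep (g : SymTensor m M) (x : M) (ξ : g.QT x) : g.cls x (g.rep x ξ) = ξ :=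
  surjInv_eq (g.radical x).mkQ_surjective ξ

/-- The diagonal entries `(0, …, 0, -1, …, -1, 1, …, 1)` with `r` zeros, `p` minus ones and `q`
ones. -/
def signEntry (r p q : ℕ) : Fin r ⊕ Fin p ⊕ Fin q → ℝ :=
  Sum.elim (fun _ => 0) (Sum.elim (fun _ => -1) (fun _ => 1))

variable [IsManifold 𝓘(ℝ, Eucl m) ∞ M]

/-- `g` is a semi-Riemannian metric of (constant) signature `(r, p, q)` on the `m`-manifold `M`:
a smooth symmetric 2-tensor such that each tangent space has a basis with
`g(e_i, e_j) = diag(0, …, 0, -1, …, -1, 1, …, 1)`. -/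
structure IsSemiRiemannian (g : SymTensor m M) (r p q : ℕ) : Prop where
  dim_eq : r + p + q = m
  smooth : ∀ (U : Set M) (X Y : VField m M), IsOpen U → SmoothFieldOn X U → SmoothFieldOn Y U →
    ContMDiffOn 𝓘(ℝ, Eucl m) 𝓘(ℝ, ℝ) ∞ (g.pair X Y) U
  signature : ∀ x : M, ∃ e : Module.Basis (Fin r ⊕ Fin p ⊕ Fin q) ℝ (TSp m x),
    ∀ i j, g.form x (e i) (e j) = if i = j then signEntry r p q i else 0

/-- The Lie derivative `(ℒ_A g)(X, Y) = A g(X, Y) - g([A, X], Y) - g(X, [A, Y])`. -/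
def SymTensor.lieDeriv (g : SymTensor m M) (A X Y : VField m M) (x : M) : ℝ :=
  fieldDeriv A (g.pair X Y) x - g.pair (fieldBracket A X) Y x - g.pair X (fieldBracket A Y) x

/-- `g` is stationary: `ℒ_A g = 0` for every locally defined smooth section `A` of the radical
distribution. -/
def SymTensor.IsStationary (g : SymTensor m M) : Prop :=
  ∀ (U : Set M) (A : VField m M), IsOpen U → SmoothFieldOn A U → (∀ x ∈ U, A x ∈ g.radical x) →
    ∀ (V : Set M) (X Y : VField m M), IsOpen V → V ⊆ U → SmoothFieldOn X V → SmoothFieldOn Y V →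
      ∀ x ∈ V, g.lieDeriv A X Y x = 0

/-! ### Koszul derivative and Koszul connection -/

/-- The right hand side of the Koszul formula. -/
def SymTensor.koszulRHS (g : SymTensor m M) (X Y Z : VField m M) (x : M) : ℝ :=
  fieldDeriv X (g.pair Y Z) x + fieldDeriv Y (g.pair Z X) x - fieldDeriv Z (g.pair X Y) x
    - g.pair X (fieldBracket Y Z) x + g.pair Y (fieldBracket Z X) x
    + g.pair Z (fieldBracket X Y) x

/-- `w` is a possible value at `x` of a Koszul derivative `D_X Y`:
`2 g(w, Z) = koszulRHS X Y Z` at `x` for all vector fields `Z` that are smooth near `x`. -/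
def SymTensor.IsKoszulValue (g : SymTensor m M) (X Y : VField m M) (x : M) (w : TSp m x) : Prop :=
  ∀ (U : Set M) (Z : VField m M), IsOpen U → x ∈ U → SmoothFieldOn Z U →
    2 * g.form x w (Z x) = g.koszulRHS X Y Z x

open Classical in
/-- A Koszul derivative `D_X Y`, determined up to the radical by the Koszul formula. If `g` is
non-degenerate, this is the Levi-Civita connection `∇_X Y`. -/
def SymTensor.koszulDeriv (g : SymTensor m M) (X Y : VField m M) : VField m M := fun x =>
  if h : ∃ w, g.IsKoszulValue X Y x w then h.choose else 0

/-- The Koszul connection `∇̄_X Ȳ = class of D_X Y` on the quotient tangent bundle, for the section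
`Ȳ` of it that is represented by the vector field `Y`. -/
def SymTensor.koszulConn (g : SymTensor m M) (X Y : VField m M) (x : M) : g.QT x :=
  g.cls x (g.koszulDeriv X Y x)

end SymTensor

/-- The trace of a bilinear map `T : V × V → W` with respect to a non-degenerate symmetric bilinear
form `B` on `V`: `∑ B^{ab} T(e_a, e_b)`, where `(e_a)` is a basis of `V` and `(B^{ab})` is the
inverse of the matrix `(B(e_a, e_b))`. -/
def metricTrace {V W : Type*} [AddCommGroup V] [Module ℝ V] [FiniteDimensional ℝ V]
    [AddCommGroup W] [Module ℝ W] (B : LinearMap.BilinForm ℝ V) (T : V → V → W) : W :=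
  let e := Module.finBasis ℝ V
  ∑ a, ∑ b, (Matrix.of fun i j => B (e i) (e j))⁻¹ a b • T (e a) (e b)

/-! ### Maps between manifolds: second fundamental forms and tension fields -/

section Maps

variable {m n : ℕ} {M N : Type*} [TopologicalSpace M] [ChartedSpace (Eucl m) M]
  [TopologicalSpace N] [ChartedSpace (Eucl n) N]

/-- The differential `dφ_x : T_x M → T_{φ x} N`. -/
abbrev tmap (m n : ℕ) {M N : Type*} [TopologicalSpace M] [ChartedSpace (Eucl m) M]
    [TopologicalSpace N] [ChartedSpace (Eucl n) N] (φ : M → N) (x : M) :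
    TSp m x →ₗ[ℝ] TSp n (φ x) :=
  (mfderiv 𝓘(ℝ, Eucl m) 𝓘(ℝ, Eucl n) φ x).toLinearMap

/-- `φ` is radical-preserving: `dφ_x (𝒩(T_x M)) ⊆ 𝒩(T_{φ x} N)` for all `x`. -/
def RadicalPreserving (g : SymTensor m M) (h : SymTensor n N) (φ : M → N) : Prop :=
  ∀ (x : M), ∀ u ∈ g.radical x, tmap m n φ x u ∈ h.radical (φ x)

/-- The generalized differential of `φ`, induced by `dφ_x` on the quotient tangent spaces. -/
def genDifferential {g : SymTensor m M} {h : SymTensor n N} {φ : M → N}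
    (hφ : RadicalPreserving g h φ) (x : M) : g.QT x →ₗ[ℝ] h.QT (φ x) :=
  (g.radical x).mapQ (h.radical (φ x)) (tmap m n φ x) (hφ x)

variable [IsManifold 𝓘(ℝ, Eucl m) ∞ M] [IsManifold 𝓘(ℝ, Eucl n) ∞ N]

/-- The vector field near `x` that is constant in the chart of `M` at `x` and has value `u`
at `x`. -/
def constField {x : M} (u : TSp m x) : VField m M :=
  FiberBundle.extend (Eucl m) (E := (TangentSpace 𝓘(ℝ, Eucl m) : M → Type)) u

/-- The derivative at `x` in the direction `u` of a section `s` of `φ⁻¹ TN`, with respect to the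
pull-back of the Koszul derivative (Levi-Civita connection, if `h` is non-degenerate) of `N`.
With `s = ∑ s^α (∂_α ∘ φ)` in the coordinate frame `(∂_α)` of the chart of `N` at `φ x` it is
`∑ u(s^α) ∂_α + ∑ s^α D_{dφ u} ∂_α`. -/
def pullbackDeriv (h : SymTensor n N) (φ : M → N) (s : ∀ x : M, TSp n (φ x)) (x : M)
    (u : TSp m x) : TSp n (φ x) :=
  let t := trivializationAt (Eucl n) (TangentSpace 𝓘(ℝ, Eucl n) : N → Type) (φ x)
  t.symm (φ x) (mvfderiv 𝓘(ℝ, Eucl m) (fun x' => (t ⟨φ x', s x'⟩).2) x u)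
    + h.koszulDeriv (constField (tmap m n φ x u)) (constField (s x)) (φ x)

/-- The second fundamental form `(∇dφ)(X, Y) = ∇_X (dφ Y) - dφ (∇_X Y)` of a map between
non-degenerate manifolds, with the connections induced by the Levi-Civita connections. -/
def secondFundForm (g : SymTensor m M) (h : SymTensor n N) (φ : M → N) (X Y : VField m M) (x : M) :
    TSp n (φ x) :=
  pullbackDeriv h φ (fun x' => tmap m n φ x' (Y x')) x (X x) - tmap m n φ x (g.koszulDeriv X Y x)

/-- The (ordinary) tension field `τ(φ) = tr_g ∇dφ` of a map between non-degenerate manifolds. -/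
def tensionField (g : SymTensor m M) (h : SymTensor n N) (φ : M → N) (x : M) : TSp n (φ x) :=
  metricTrace (g.form x) fun u v => secondFundForm g h φ (constField u) (constField v) x

/-- A map between non-degenerate manifolds is harmonic if its tension field vanishes. -/
def IsHarmonic (g : SymTensor m M) (h : SymTensor n N) (φ : M → N) : Prop :=
  ∀ x, tensionField g h φ x = 0

/-- The generalized second fundamental form
`B̄(X̄, Ȳ) = ∇̄_X (dφ̄ Ȳ) - dφ̄ (∇̄_X Ȳ)` of a radical-preserving map. -/
def genSecondFundForm {g : SymTensor m M} {h : SymTensor n N} {φ : M → N}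
    (hφ : RadicalPreserving g h φ) (X Y : VField m M) (x : M) : h.QT (φ x) :=
  h.cls (φ x) (pullbackDeriv h φ (fun x' => tmap m n φ x' (Y x')) x (X x))
    - genDifferential hφ x (g.koszulConn X Y x)

/-- The generalized tension field `τ̄(φ) = tr_ḡ B̄` of a radical-preserving map. -/
def genTensionField {g : SymTensor m M} {h : SymTensor n N} {φ : M → N}
    (hφ : RadicalPreserving g h φ) (x : M) : h.QT (φ x) :=
  metricTrace (g.barForm x) fun ξ η =>
    genSecondFundForm hφ (constField (g.rep x ξ)) (constField (g.rep x η)) x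

/-- A radical-preserving map is generalized harmonic if its generalized tension field vanishes. -/
def IsGenHarmonic {g : SymTensor m M} {h : SymTensor n N} {φ : M → N}
    (hφ : RadicalPreserving g h φ) : Prop :=
  ∀ x, genTensionField hφ x = 0

end Maps

/-! ### The leaf space of the radical foliation -/

section Leaf

variable {m n : ℕ} {M N : Type*} [TopologicalSpace M] [ChartedSpace (Eucl m) M]
  [TopologicalSpace N] [ChartedSpace (Eucl n) N]

/-- `x` and `y` lie on a `C¹` curve that is everywhere tangent to the radical distribution. -/
def SymTensor.OnRadicalCurve (g : SymTensor m M) (x y : M) : Prop :=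
  ∃ (γ : ℝ → M) (a b s t : ℝ), s ∈ Ioo a b ∧ t ∈ Ioo a b ∧
    ContMDiffOn 𝓘(ℝ, ℝ) 𝓘(ℝ, Eucl m) 1 γ (Ioo a b) ∧
    (∀ c ∈ Ioo a b, mfderiv 𝓘(ℝ, ℝ) 𝓘(ℝ, Eucl m) γ c (1 : ℝ) ∈ g.radical (γ c)) ∧
    γ s = x ∧ γ t = y

/-- Two points are equivalent if they lie on the same leaf of the radical foliation, that is, if
they are joined by a finite chain of curves tangent to the radical distribution. -/
def SymTensor.leafSetoid (g : SymTensor m M) : Setoid M := Relation.EqvGen.setoid g.OnRadicalCurve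

/-- The leaf space `M̄` of the radical foliation, with the quotient topology. -/
abbrev SymTensor.LeafSpace (g : SymTensor m M) : Type _ := Quotient g.leafSetoid

/-- The projection `π_M : M → M̄`. -/
def SymTensor.leafProj (g : SymTensor m M) : M → g.LeafSpace := Quotient.mk g.leafSetoid

theorem RadicalPreserving.leaf_rel {g : SymTensor m M} {h : SymTensor n N} {φ : M → N}
    (hφ : RadicalPreserving g h φ) (hC : ContMDiff 𝓘(ℝ, Eucl m) 𝓘(ℝ, Eucl n) 2 φ) (x y : M)
    (hxy : g.leafSetoid x y) : h.leafSetoid (φ x) (φ y) := by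
  induction hxy with
  | rel x y hxy =>
    obtain ⟨γ, a, b, s, t, hs, ht, hγ, hrad, rfl, rfl⟩ := hxy
    refine Relation.EqvGen.rel _ _ ⟨φ ∘ γ, a, b, s, t, hs, ht, ?_, ?_, rfl, rfl⟩
    · exact (hC.of_le (by norm_num)).comp_contMDiffOn hγ
    · intro c hc
      have h1 : MDifferentiableAt 𝓘(ℝ, ℝ) 𝓘(ℝ, Eucl m) γ c :=
        ((hγ c hc).contMDiffAt (isOpen_Ioo.mem_nhds hc)).mdifferentiableAt one_ne_zero
      have h2 : MDifferentiableAt 𝓘(ℝ, Eucl m) 𝓘(ℝ, Eucl n) φ (γ c) :=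
        (hC (γ c)).mdifferentiableAt two_ne_zero
      rw [mfderiv_comp c h2 h1]
      exact hφ (γ c) _ (hrad c hc)
  | refl x => exact Relation.EqvGen.refl _
  | symm x y _ ih => exact Relation.EqvGen.symm _ _ ih
  | trans x y z _ _ ih1 ih2 => exact Relation.EqvGen.trans _ _ _ ih1 ih2

/-- The map `φ̄ : M̄ → N̄`, `φ̄ [x] = [φ x]`, induced by a radical-preserving map. -/
def leafMap {g : SymTensor m M} {h : SymTensor n N} {φ : M → N} (hφ : RadicalPreserving g h φ)
    (hC : ContMDiff 𝓘(ℝ, Eucl m) 𝓘(ℝ, Eucl n) 2 φ) : g.LeafSpace → h.LeafSpace :=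
  Quotient.map φ (hφ.leaf_rel hC)

variable {k : ℕ} (g : SymTensor m M) [ChartedSpace (Eucl k) g.LeafSpace]

open Classical in
/-- The map `Ψ_x : T_x M / 𝒩(T_x M) → T_{[x]} M̄` induced by `(dπ_M)_x`. -/
def SymTensor.leafIso (k : ℕ) [ChartedSpace (Eucl k) g.LeafSpace] (x : M) :
    g.QT x →ₗ[ℝ] TSp k (g.leafProj x) :=
  if H : g.radical x ≤ LinearMap.ker (tmap m k g.leafProj x) then
    (g.radical x).liftQ (tmap m k g.leafProj x) H
  else 0

open Classical in
/-- The form `(Ψ_x⁻¹)^* ḡ` on `T_{[x]} M̄`. -/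
def SymTensor.leafForm (k : ℕ) [ChartedSpace (Eucl k) g.LeafSpace] (x : M) :
    LinearMap.BilinForm ℝ (TSp k (g.leafProj x)) :=
  if H : Bijective (g.leafIso k x) then
    (g.barForm x).compl₁₂ (LinearEquiv.ofBijective _ H).symm.toLinearMap
      (LinearEquiv.ofBijective _ H).symm.toLinearMap
  else 0

theorem SymTensor.barForm_symm (x : M) (ξ η : g.QT x) : g.barForm x ξ η = g.barForm x η ξ := by
  rw [← g.cls_rep x ξ, ← g.cls_rep x η, g.barForm_cls, g.barForm_cls, g.symm]

theorem SymTensor.leafForm_symm (x : M) (u v : TSp k (g.leafProj x)) :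
    g.leafForm k x u v = g.leafForm k x v u := by
  unfold SymTensor.leafForm
  split_ifs with H
  · exact g.barForm_symm x _ _
  · rfl

theorem SymTensor.leafProj_out (y : g.LeafSpace) : g.leafProj (Quotient.out y) = y :=
  Quotient.out_eq y

/-- The metric `g^{M̄} = (Ψ⁻¹)^* ḡ` induced on the leaf space (computed at a point of each leaf). -/
def SymTensor.leafMetric (k : ℕ) [ChartedSpace (Eucl k) g.LeafSpace] :
    SymTensor k g.LeafSpace where
  form y := g.leafProj_out y ▸ g.leafForm k (Quotient.out y)
  symm y := by
    have key : ∀ (z z' : g.LeafSpace) (e : z = z') (B : LinearMap.BilinForm ℝ (TSp k z)),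
        (∀ u v, B u v = B v u) →
        ∀ u v : TSp k z', (e ▸ B : LinearMap.BilinForm ℝ (TSp k z')) u v
          = (e ▸ B : LinearMap.BilinForm ℝ (TSp k z')) v u := by
      intro z z' e B hB
      subst e
      exact hB
    exact key _ _ (g.leafProj_out y) _ (g.leafForm_symm _)

end Leaf

end

/-! Everything rests on the square $\overline\phi\circ\pi_M=\pi_N\circ\phi$ and on the composition
law $B^{\psi\circ\phi}=d\psi\,B^\phi+B^\psi(d\phi,d\phi)$ (`secondFundForm_comp`). Both projections
pull a non-degenerate metric back to the given degenerate one, which makes them totally geodesic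
(`secondFundForm_eq_zero_of_pullback`). Expanding the second fundamental form of the diagonal of the
square in two ways gives $d\pi_N B^\phi(u,v)=B^{\overline\phi}(d\pi_M u,d\pi_M v)$
(`tmap_leafProj_secondFundForm`). Since $\Psi^M$ is an isometry, taking traces (`map_metricTrace`)
turns this into the identity of tension fields; injectivity of $\Psi^N$ and surjectivity of $\pi_M$
then give the statement on harmonicity.

The leaf spaces must first carry these metrics. A radical vector extends to a smooth radical
section, because kernels of constant rank have smooth sections (`exists_contDiffAt_ker_section`).
Its integral curve stays in one leaf, so $d\pi$ kills the vector (`radical_le_ker`); a dimension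
count makes the radical the whole kernel, and $\Psi$ is bijective.

Stationarity enters only to show that the induced form is independent of the point of the leaf. With
$R$ a smooth right inverse of $d\pi$ in charts, the coefficients of the form are
$g(R\alpha,R\beta)$. Differentiating $d\pi(A)=0$ and $d\pi\circ R=\mathrm{id}$ shows that along a
radical section $A$ their derivative is $(\mathcal L_Ag)(R\alpha,R\beta)=0$
(`fderiv_gram_rightInverse_eq_zero`). Smoothness of the metric and the $C^2$ property of
$\overline\phi$ come from local sections of the submersions. -/

noncomputable section

/-! ### Tangent vectors, vector fields and brackets in a chart -/

section Coordinates

variable {m n : ℕ} {M N : Type*} [TopologicalSpace M] [ChartedSpace (Eucl m) M]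

/-- The point `x` in its own chart. -/
abbrev chartPt (x : M) : Eucl m := extChartAt 𝓘(ℝ, Eucl m) x x

theorem chart_symm_mem {x : M} {e : Eucl m} (he : e ∈ (extChartAt 𝓘(ℝ, Eucl m) x).target) :
    (extChartAt 𝓘(ℝ, Eucl m) x).symm e ∈ (chartAt (Eucl m) x).source := by
  have := (extChartAt 𝓘(ℝ, Eucl m) x).map_target he
  rwa [extChartAt_source] at this

theorem eventually_target (x : M) :
    ∀ᶠ e in 𝓝 (chartPt x), e ∈ (extChartAt 𝓘(ℝ, Eucl m) x).target :=
  extChartAt_target_mem_nhds x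

variable [IsManifold 𝓘(ℝ, Eucl m) ∞ M]

/-- The coordinates of a tangent vector at `z` in the chart at `x`. -/
def tcoord (x z : M) : TSp m z →L[ℝ] Eucl m :=
  (trivializationAt (Eucl m) (TangentSpace 𝓘(ℝ, Eucl m) : M → Type) x).continuousLinearMapAt ℝ z

/-- The tangent vector at `z` with given coordinates in the chart at `x`. -/
def tvec (x z : M) : Eucl m →L[ℝ] TSp m z :=
  (trivializationAt (Eucl m) (TangentSpace 𝓘(ℝ, Eucl m) : M → Type) x).symmL ℝ z

theorem tcoord_tvec {x z : M} (hz : z ∈ (chartAt (Eucl m) x).source) (v : Eucl m) :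
    tcoord x z (tvec x z v) = v :=
  (trivializationAt (Eucl m) (TangentSpace 𝓘(ℝ, Eucl m) : M → Type) x).continuousLinearMapAt_symmL
    hz v

theorem tvec_tcoord {x z : M} (hz : z ∈ (chartAt (Eucl m) x).source) (v : TSp m z) :
    tvec x z (tcoord x z v) = v :=
  (trivializationAt (Eucl m) (TangentSpace 𝓘(ℝ, Eucl m) : M → Type) x).symmL_continuousLinearMapAt
    hz v

theorem tcoord_eq_mfderiv {x z : M} (hz : z ∈ (chartAt (Eucl m) x).source) :
    tcoord x z = mfderiv 𝓘(ℝ, Eucl m) 𝓘(ℝ, Eucl m) (extChartAt 𝓘(ℝ, Eucl m) x) z :=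
  TangentBundle.continuousLinearMapAt_trivializationAt hz

theorem tvec_eq_mfderivWithin {x z : M} (hz : z ∈ (chartAt (Eucl m) x).source) :
    tvec x z = mfderivWithin 𝓘(ℝ, Eucl m) 𝓘(ℝ, Eucl m) (extChartAt 𝓘(ℝ, Eucl m) x).symm
      (range 𝓘(ℝ, Eucl m)) (extChartAt 𝓘(ℝ, Eucl m) x z) :=
  TangentBundle.symmL_trivializationAt hz

theorem tcoord_apply {x z : M} (hz : z ∈ (chartAt (Eucl m) x).source) (v : TSp m z) :
    tcoord x z v =
      ((trivializationAt (Eucl m) (TangentSpace 𝓘(ℝ, Eucl m) : M → Type) x) ⟨z, v⟩).2 :=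
  congrFun ((trivializationAt (Eucl m) (TangentSpace 𝓘(ℝ, Eucl m) : M → Type)
    x).coe_linearMapAt_of_mem (R := ℝ) hz) v

/-- The identity `T_x M = ℝ^m` underlying Mathlib's tangent spaces. -/
theorem tcoord_self (x : M) (u : TSp m x) : tcoord x x u = (u : Eucl m) := by
  have h1 := tcoord_eq_mfderiv (mem_chart_source (Eucl m) x)
  have h2 := mfderiv_extChartAt_self (I := 𝓘(ℝ, Eucl m)) (x := x)
  exact congrArg (fun f => f u) (h1.trans h2)

theorem tcoord_tvec_self (x : M) (v : Eucl m) : tcoord x x (tvec x x v) = v :=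
  tcoord_tvec (mem_chart_source _ x) v

theorem tvec_tcoord_self (x : M) (v : TSp m x) : tvec x x (tcoord x x v) = v :=
  tvec_tcoord (mem_chart_source _ x) v

theorem constField_eq {x : M} (u : TSp m x) {z : M} (hz : z ∈ (chartAt (Eucl m) x).source) :
    constField u z = tvec x z (tcoord x x u) := by
  rw [tcoord_apply (mem_chart_source _ x)]
  exact ((trivializationAt (Eucl m) (TangentSpace 𝓘(ℝ, Eucl m) : M → Type)
    x).symmL_apply (R := ℝ) hz _).symm

theorem constField_self {x : M} (u : TSp m x) : constField u x = u := by
  rw [constField_eq u (mem_chart_source _ x), tvec_tcoord_self]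

/-- A vector field in the coordinates of the chart at `x`. -/
def coordField (x : M) (X : VField m M) (e : Eucl m) : Eucl m :=
  tcoord x ((extChartAt 𝓘(ℝ, Eucl m) x).symm e) (X ((extChartAt 𝓘(ℝ, Eucl m) x).symm e))

theorem coordField_constField {x : M} (u : TSp m x) {e : Eucl m}
    (he : e ∈ (extChartAt 𝓘(ℝ, Eucl m) x).target) :
    coordField x (constField u) e = tcoord x x u := by
  rw [coordField, constField_eq u (chart_symm_mem he), tcoord_tvec (chart_symm_mem he)]

theorem coordField_self (x : M) (X : VField m M) :
    coordField x X (chartPt x) = tcoord x x (X x) := by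
  rw [coordField, extChartAt_to_inv]

theorem smoothFieldOn_constField {x : M} (u : TSp m x) :
    SmoothFieldOn (constField u) (chartAt (Eucl m) x).source := by
  refine ((trivializationAt (Eucl m) (TangentSpace 𝓘(ℝ, Eucl m) : M → Type)
    x).contMDiffOn_section_baseSet_iff (IB := 𝓘(ℝ, Eucl m)) (n := ∞)
    (s := constField u)).2 ?_
  refine (contMDiffOn_const (c := tcoord x x u)).congr fun z hz => ?_
  exact (tcoord_apply hz _).symm.trans (by rw [constField_eq u hz, tcoord_tvec hz])

theorem SmoothFieldOn.contDiffAt_coordField {x : M} {X : VField m M} {U : Set M}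
    (hX : SmoothFieldOn X U) (hU : U ∈ 𝓝 x) :
    ContDiffAt ℝ ∞ (coordField x X) (chartPt x) := by
  have h1 : ContMDiffAt 𝓘(ℝ, Eucl m) 𝓘(ℝ, Eucl m).tangent ∞
    (fun x => (⟨x, X x⟩ : TangentBundle 𝓘(ℝ, Eucl m) M)) x := hX.contMDiffAt hU
  have h2 := (Bundle.contMDiffAt_section (IB := 𝓘(ℝ, Eucl m)) (n := ∞) (s := X) x).1 h1
  have h3 := h2.comp_of_eq (x := chartPt x)
    (contMDiffOn_extChartAt_symm (n := ∞) x |>.contMDiffAt (extChartAt_target_mem_nhds x))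
    (extChartAt_to_inv x)
  rw [contMDiffAt_iff_contDiffAt] at h3
  refine h3.congr_of_eventuallyEq ?_
  filter_upwards [eventually_target x] with e he
  exact tcoord_apply (chart_symm_mem he) _

/-- The vector field with given coordinates in the chart at `x`. -/
def chartField (x : M) (A : Eucl m → Eucl m) : VField m M :=
  fun z => tvec x z (A (extChartAt 𝓘(ℝ, Eucl m) x z))

theorem chartField_self (x : M) (A : Eucl m → Eucl m) :
    chartField x A x = tvec x x (A (chartPt x)) := rfl

theorem coordField_chartField (x : M) (A : Eucl m → Eucl m) {e : Eucl m}
    (he : e ∈ (extChartAt 𝓘(ℝ, Eucl m) x).target) : coordField x (chartField x A) e = A e := by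
  rw [coordField, chartField, tcoord_tvec (chart_symm_mem he), PartialEquiv.right_inv _ he]

theorem smoothFieldOn_chartField (x : M) {A : Eucl m → Eucl m} {V : Set (Eucl m)}
    (hV : IsOpen V) (hA : ContDiffOn ℝ ∞ A V) :
    SmoothFieldOn (chartField x A)
      ((extChartAt 𝓘(ℝ, Eucl m) x).source ∩ extChartAt 𝓘(ℝ, Eucl m) x ⁻¹' V) := by
  have hs : (extChartAt 𝓘(ℝ, Eucl m) x).source = (chartAt (Eucl m) x).source :=
    extChartAt_source 𝓘(ℝ, Eucl m) x
  refine ((trivializationAt (Eucl m) (TangentSpace 𝓘(ℝ, Eucl m) : M → Type)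
    x).contMDiffOn_section_iff (IB := 𝓘(ℝ, Eucl m)) (n := ∞)
    (s := chartField x A) (isOpen_extChartAt_preimage' x hV) ?_).2 ?_
  · exact fun z hz => (hs ▸ hz.1 : z ∈ (chartAt (Eucl m) x).source)
  have h1 : ContMDiffOn 𝓘(ℝ, Eucl m) 𝓘(ℝ, Eucl m) ∞ (A ∘ extChartAt 𝓘(ℝ, Eucl m) x)
      ((extChartAt 𝓘(ℝ, Eucl m) x).source ∩ extChartAt 𝓘(ℝ, Eucl m) x ⁻¹' V) :=
    hA.contMDiffOn.comp ((contMDiffOn_extChartAt (n := ∞)).mono (fun z hz => hs ▸ hz.1))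
      (fun z hz => hz.2)
  refine h1.congr fun z hz => ?_
  have hz' : z ∈ (chartAt (Eucl m) x).source := hs ▸ hz.1
  exact (tcoord_apply hz' _).symm.trans (by rw [chartField, tcoord_tvec hz']; rfl)

theorem fieldDeriv_eq (X : VField m M) {f : M → ℝ} {x : M}
    (hf : MDifferentiableAt 𝓘(ℝ, Eucl m) 𝓘(ℝ, ℝ) f x) :
    fieldDeriv X f x =
      fderiv ℝ (f ∘ (extChartAt 𝓘(ℝ, Eucl m) x).symm) (chartPt x) (tcoord x x (X x)) := by
  rw [tcoord_self]
  unfold fieldDeriv mvfderiv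
  rw [hf.mfderiv]
  simp only [writtenInExtChartAt, modelWithCornersSelf_coe, range_id, fderivWithin_univ]
  rfl

theorem tvec_inverse {x z : M} (hz : z ∈ (chartAt (Eucl m) x).source) :
    (tvec x z).inverse = tcoord (m := m) x z :=
  ContinuousLinearMap.inverse_eq (ContinuousLinearMap.ext fun v => tvec_tcoord hz v)
    (ContinuousLinearMap.ext fun v => tcoord_tvec hz v)

theorem tcoord_inverse {x z : M} (hz : z ∈ (chartAt (Eucl m) x).source) :
    (tcoord x z).inverse = tvec (m := m) x z :=
  ContinuousLinearMap.inverse_eq (ContinuousLinearMap.ext fun v => tcoord_tvec hz v)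
    (ContinuousLinearMap.ext fun v => tvec_tcoord hz v)

/-- The manifold bracket is the flat bracket of the fields pulled back by the inverse chart. Near
the base point these pullbacks are the coordinate fields, and the flat bracket depends only on
germs. -/
theorem tcoord_fieldBracket (X Y : VField m M) (x : M) :
    tcoord x x (fieldBracket X Y x) = fderiv ℝ (coordField x Y) (chartPt x) (tcoord x x (X x))
      - fderiv ℝ (coordField x X) (chartPt x) (tcoord x x (Y x)) := by
  have key : ∀ Z : VField m M, (VectorField.mpullbackWithin 𝓘(ℝ, Eucl m) 𝓘(ℝ, Eucl m)
      (extChartAt 𝓘(ℝ, Eucl m) x).symm Z (range 𝓘(ℝ, Eucl m))) =ᶠ[𝓝 (chartPt x)]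
      coordField x Z := by
    intro Z
    filter_upwards [eventually_target x] with e he
    have h3 := tvec_eq_mfderivWithin (chart_symm_mem he)
    rw [PartialEquiv.right_inv _ he] at h3
    rw [VectorField.mpullbackWithin_apply, ← h3]
    exact congrArg (fun f : TSp m _ →L[ℝ] Eucl m => f (Z _)) (tvec_inverse (chart_symm_mem he))
  have h1 := tcoord_eq_mfderiv (mem_chart_source (Eucl m) x)
  have h2 : ∀ (V W V' W' : Eucl m → Eucl m) (s : Set (Eucl m)) (e : Eucl m), V =ᶠ[𝓝 e] V' →
      W =ᶠ[𝓝 e] W' → s = univ →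
      VectorField.lieBracketWithin ℝ V W s e = VectorField.lieBracket ℝ V' W' e := by
    intro V W V' W' s e hV hW hs
    rw [hs, VectorField.lieBracketWithin_univ, hV.lieBracket_vectorField_eq hW]
  have h3 : fieldBracket X Y x = (tcoord x x).inverse
      (VectorField.lieBracket ℝ (coordField x X) (coordField x Y) (chartPt x)) := by
    rw [← h2 _ _ _ _ ((extChartAt 𝓘(ℝ, Eucl m) x).symm ⁻¹' univ ∩ range 𝓘(ℝ, Eucl m))
      _ (key X) (key Y)
      (by rw [modelWithCornersSelf_coe, range_id, preimage_univ, univ_inter])]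
    exact congrArg (fun f : TSp m x →L[ℝ] Eucl m => f.inverse _) h1.symm
  rw [h3, tcoord_inverse (mem_chart_source _ x), tcoord_tvec_self,
    VectorField.lieBracket, coordField_self, coordField_self]

end Coordinates

/-! ### Maps in charts and their second fundamental form -/

section LocalMaps

variable {m n k : ℕ} {M N L : Type*} [TopologicalSpace M] [ChartedSpace (Eucl m) M]
  [TopologicalSpace N] [ChartedSpace (Eucl n) N] [TopologicalSpace L] [ChartedSpace (Eucl k) L]

/-- The map `φ` in the charts at `x` and `y`. -/
def localMap (m n : ℕ) {M N : Type*} [TopologicalSpace M] [ChartedSpace (Eucl m) M]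
    [TopologicalSpace N] [ChartedSpace (Eucl n) N] (φ : M → N) (x : M) (y : N) :
    Eucl m → Eucl n :=
  extChartAt 𝓘(ℝ, Eucl n) y ∘ φ ∘ (extChartAt 𝓘(ℝ, Eucl m) x).symm

theorem localMap_chartPt (φ : M → N) (x : M) :
    localMap m n φ x (φ x) (chartPt x) = chartPt (φ x) := by
  simp only [localMap, comp_apply, chartPt, extChartAt_to_inv]

theorem localMap_comp {φ : M → N} (ψ : N → L) {x : M} (hφ : ContinuousAt φ x) :
    ∀ᶠ e in 𝓝 (chartPt x), localMap m k (ψ ∘ φ) x (ψ (φ x)) e =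
      localMap n k ψ (φ x) (ψ (φ x)) (localMap m n φ x (φ x) e) := by
  have h1 : Filter.Tendsto (φ ∘ (extChartAt 𝓘(ℝ, Eucl m) x).symm) (𝓝 (chartPt x)) (𝓝 (φ x)) :=
    hφ.tendsto.comp ((continuousAt_extChartAt_symm (I := 𝓘(ℝ, Eucl m)) x).tendsto.mono_right
      (by rw [extChartAt_to_inv]))
  filter_upwards [h1.eventually (extChartAt_source_mem_nhds (I := 𝓘(ℝ, Eucl n)) (φ x))] with e he
  simp only [localMap, comp_apply] at he ⊢
  rw [PartialEquiv.left_inv _ he]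

theorem ContMDiffAt.contDiffAt_localMap {φ : M → N} {x : M} {r : WithTop ℕ∞}
    (hφ : ContMDiffAt 𝓘(ℝ, Eucl m) 𝓘(ℝ, Eucl n) r φ x) :
    ContDiffAt ℝ r (localMap m n φ x (φ x)) (chartPt x) := by
  have := (contMDiffAt_iff.1 hφ).2
  rwa [modelWithCornersSelf_coe, range_id, contDiffWithinAt_univ] at this

theorem eventually_source (x : M) :
    ∀ᶠ z in 𝓝 x, z ∈ (chartAt (Eucl m) x).source := chart_source_mem_nhds (Eucl m) x

theorem tendsto_chart_symm (x : M) :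
    Filter.Tendsto (extChartAt 𝓘(ℝ, Eucl m) x).symm (𝓝 (chartPt x)) (𝓝 x) := by
  have := (continuousAt_extChartAt_symm (I := 𝓘(ℝ, Eucl m)) x).tendsto
  rwa [extChartAt_to_inv] at this

variable [IsManifold 𝓘(ℝ, Eucl m) ∞ M] [IsManifold 𝓘(ℝ, Eucl n) ∞ N]
  [IsManifold 𝓘(ℝ, Eucl k) ∞ L]

theorem hasFDerivAt_localMap {φ : M → N} {x z : M} {y : N}
    (hφ : MDifferentiableAt 𝓘(ℝ, Eucl m) 𝓘(ℝ, Eucl n) φ z)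
    (hz : z ∈ (chartAt (Eucl m) x).source) (hy : φ z ∈ (chartAt (Eucl n) y).source) :
    HasFDerivAt (localMap m n φ x y)
      (tcoord y (φ z) ∘L mfderiv 𝓘(ℝ, Eucl m) 𝓘(ℝ, Eucl n) φ z ∘L tvec x z)
      (extChartAt 𝓘(ℝ, Eucl m) x z) := by
  have hz' : z ∈ (extChartAt 𝓘(ℝ, Eucl m) x).source := by rwa [extChartAt_source]
  have h1 : HasMFDerivAt 𝓘(ℝ, Eucl m) 𝓘(ℝ, Eucl m) (extChartAt 𝓘(ℝ, Eucl m) x).symm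
      (extChartAt 𝓘(ℝ, Eucl m) x z) (tvec x z) := by
    have h := (mdifferentiableWithinAt_extChartAt_symm (I := 𝓘(ℝ, Eucl m))
      ((extChartAt 𝓘(ℝ, Eucl m) x).map_source hz')).hasMFDerivWithinAt
    rw [← tvec_eq_mfderivWithin hz] at h
    rw [modelWithCornersSelf_coe, range_id] at h
    exact hasMFDerivWithinAt_univ.1 h
  have h3 : HasMFDerivAt 𝓘(ℝ, Eucl n) 𝓘(ℝ, Eucl n) (extChartAt 𝓘(ℝ, Eucl n) y) (φ z)
      (tcoord y (φ z)) := by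
    rw [tcoord_eq_mfderiv hy]
    exact (mdifferentiableAt_extChartAt hy).hasMFDerivAt
  have hinv : (extChartAt 𝓘(ℝ, Eucl m) x).symm (extChartAt 𝓘(ℝ, Eucl m) x z) = z :=
    (extChartAt 𝓘(ℝ, Eucl m) x).left_inv hz'
  have h4 : HasMFDerivAt 𝓘(ℝ, Eucl m) 𝓘(ℝ, Eucl n) (extChartAt 𝓘(ℝ, Eucl n) y ∘ φ) z
      (tcoord y (φ z) ∘L mfderiv 𝓘(ℝ, Eucl m) 𝓘(ℝ, Eucl n) φ z) :=
    HasMFDerivAt.comp z h3 hφ.hasMFDerivAt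
  -- The chain rule needs the derivative at the image of `z` under the chart followed by its
  -- inverse. That point equals `z` only propositionally and the tangent spaces depend on it, hence
  -- a general `w`.
  have h5 : ∀ w, w = z → HasMFDerivAt 𝓘(ℝ, Eucl m) 𝓘(ℝ, Eucl n) (extChartAt 𝓘(ℝ, Eucl n) y ∘ φ) w
      (tcoord y (φ z) ∘L mfderiv 𝓘(ℝ, Eucl m) 𝓘(ℝ, Eucl n) φ z : Eucl m →L[ℝ] Eucl n) := by
    intro w hw
    subst hw
    exact h4
  have h6 := HasMFDerivAt.comp (extChartAt 𝓘(ℝ, Eucl m) x z) (h5 _ hinv) h1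
  exact hasMFDerivAt_iff_hasFDerivAt.1 h6

theorem eventually_contMDiffAt {φ : M → N} {x : M}
    (hφ : ContMDiffAt 𝓘(ℝ, Eucl m) 𝓘(ℝ, Eucl n) 1 φ x) :
    ∀ᶠ z in 𝓝 x, ContMDiffAt 𝓘(ℝ, Eucl m) 𝓘(ℝ, Eucl n) 1 φ z :=
  (contMDiffAt_iff_contMDiffAt_nhds (by simp)).1 hφ

/-- The differential in coordinates, near `x`. -/
theorem tcoord_tmap {φ : M → N} {x : M} {r : WithTop ℕ∞} (hr : 1 ≤ r)
    (hφ : ContMDiffAt 𝓘(ℝ, Eucl m) 𝓘(ℝ, Eucl n) r φ x) :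
    ∀ᶠ z in 𝓝 x, ∀ v : TSp m z, tcoord (φ x) (φ z) (tmap m n φ z v) =
      fderiv ℝ (localMap m n φ x (φ x)) (extChartAt 𝓘(ℝ, Eucl m) x z) (tcoord x z v) := by
  have h1 : ∀ᶠ z in 𝓝 x, ContMDiffAt 𝓘(ℝ, Eucl m) 𝓘(ℝ, Eucl n) 1 φ z :=
    eventually_contMDiffAt (hφ.of_le hr)
  filter_upwards [h1, eventually_source (m := m) x, hφ.continuousAt.tendsto.eventually
    (eventually_source (m := n) (φ x))] with z hz1 hz2 hz3 v
  rw [(hasFDerivAt_localMap (hz1.mdifferentiableAt one_ne_zero) hz2 hz3).fderiv,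
    ContinuousLinearMap.comp_apply, ContinuousLinearMap.comp_apply, tvec_tcoord hz2]
  rfl

theorem tcoord_tmap_self {φ : M → N} {x : M}
    (hφ : MDifferentiableAt 𝓘(ℝ, Eucl m) 𝓘(ℝ, Eucl n) φ x) (v : TSp m x) :
    tcoord (φ x) (φ x) (tmap m n φ x v) =
      fderiv ℝ (localMap m n φ x (φ x)) (chartPt x) (tcoord x x v) := by
  rw [(hasFDerivAt_localMap hφ (mem_chart_source _ x) (mem_chart_source _ (φ x))).fderiv,
    ContinuousLinearMap.comp_apply, ContinuousLinearMap.comp_apply, tvec_tcoord_self]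
  rfl

theorem mvfderiv_eq {f : M → Eucl n} {x : M}
    (hf : MDifferentiableAt 𝓘(ℝ, Eucl m) 𝓘(ℝ, Eucl n) f x) (u : TSp m x) :
    mvfderiv 𝓘(ℝ, Eucl m) f x u =
      fderiv ℝ (f ∘ (extChartAt 𝓘(ℝ, Eucl m) x).symm) (chartPt x) (tcoord x x u) := by
  rw [tcoord_self]
  unfold mvfderiv
  rw [hf.mfderiv]
  simp only [writtenInExtChartAt, modelWithCornersSelf_coe, range_id, fderivWithin_univ]
  rfl

/-- The second fundamental form in coordinates. -/
theorem tcoord_secondFundForm (g : SymTensor m M) (h : SymTensor n N) {φ : M → N} {x : M}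
    (hφ : ContMDiffAt 𝓘(ℝ, Eucl m) 𝓘(ℝ, Eucl n) 2 φ x) (u v : TSp m x) :
    tcoord (φ x) (φ x) (secondFundForm g h φ (constField u) (constField v) x) =
      fderiv ℝ (fderiv ℝ (localMap m n φ x (φ x))) (chartPt x) (tcoord x x u) (tcoord x x v)
      + tcoord (φ x) (φ x) (h.koszulDeriv (constField (tmap m n φ x u))
          (constField (tmap m n φ x v)) (φ x))
      - tcoord (φ x) (φ x) (tmap m n φ x (g.koszulDeriv (constField u) (constField v) x)) := by
  set Φ := localMap m n φ x (φ x) with hΦ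
  have hΦ2 : ContDiffAt ℝ 2 Φ (chartPt x) := hφ.contDiffAt_localMap
  have hΦ1 : DifferentiableAt ℝ (fderiv ℝ Φ) (chartPt x) :=
    (hΦ2.fderiv_right (m := 1) (by norm_num)).differentiableAt one_ne_zero
  have hΦv : DifferentiableAt ℝ (fun e => fderiv ℝ Φ e (tcoord x x v)) (chartPt x) :=
    hΦ1.clm_apply (differentiableAt_const _)
  -- This is the coordinate function differentiated inside `pullbackDeriv`. Near `x` it reads
  -- $e\mapsto D\Phi(e)v$ in the chart, so its derivative is $D^2\Phi$.
  let f : M → Eucl n := fun z => (trivializationAt (Eucl n) (TangentSpace 𝓘(ℝ, Eucl n) : N → Type)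
    (φ x) ⟨φ z, tmap m n φ z (constField v z)⟩).2
  have hf : f =ᶠ[𝓝 x] (fun e => fderiv ℝ Φ e (tcoord x x v)) ∘ extChartAt 𝓘(ℝ, Eucl m) x := by
    filter_upwards [tcoord_tmap (by norm_num) hφ, eventually_source (m := m) x,
      hφ.continuousAt.tendsto.eventually (eventually_source (m := n) (φ x))] with z hz hz2 hz3
    have := hz (constField v z)
    rw [tcoord_apply hz3] at this
    refine this.trans ?_
    rw [constField_eq v hz2, tcoord_tvec hz2]
    rfl
  have hfd : MDifferentiableAt 𝓘(ℝ, Eucl m) 𝓘(ℝ, Eucl n) f x := by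
    refine MDifferentiableAt.congr_of_eventuallyEq ?_ hf
    have a : MDifferentiableAt 𝓘(ℝ, Eucl m) 𝓘(ℝ, Eucl n) (fun e => fderiv ℝ Φ e (tcoord x x v))
        (chartPt x) := hΦv.mdifferentiableAt
    have b : MDifferentiableAt 𝓘(ℝ, Eucl m) 𝓘(ℝ, Eucl m) (extChartAt 𝓘(ℝ, Eucl m) x) x :=
      mdifferentiableAt_extChartAt (mem_chart_source _ x)
    exact MDifferentiableAt.comp x a b
  have hfe : f ∘ (extChartAt 𝓘(ℝ, Eucl m) x).symm =ᶠ[𝓝 (chartPt x)]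
      fun e => fderiv ℝ Φ e (tcoord x x v) := by
    filter_upwards [(tendsto_chart_symm x).eventually hf, eventually_target x] with e he he2
    rw [comp_apply, he, comp_apply, PartialEquiv.right_inv _ he2]
  have h1 : mvfderiv 𝓘(ℝ, Eucl m) f x u =
      fderiv ℝ (fderiv ℝ Φ) (chartPt x) (tcoord x x u) (tcoord x x v) := by
    rw [mvfderiv_eq hfd, hfe.fderiv_eq, fderiv_clm_apply hΦ1 (differentiableAt_const _)]
    simp only [fderiv_fun_const, Pi.zero_apply, ContinuousLinearMap.comp_zero, zero_add,
      ContinuousLinearMap.flip_apply]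
  have h2 : pullbackDeriv h φ (fun x' => tmap m n φ x' (constField v x')) x (constField u x) =
      tvec (φ x) (φ x) (mvfderiv 𝓘(ℝ, Eucl m) f x u) + h.koszulDeriv
        (constField (tmap m n φ x u)) (constField (tmap m n φ x v)) (φ x) := by
    unfold pullbackDeriv
    rw [constField_self u]
    beta_reduce
    rw [constField_self v]
    refine congrArg (· + h.koszulDeriv (constField (tmap m n φ x u))
      (constField (tmap m n φ x v)) (φ x)) ?_
    exact ((trivializationAt (Eucl n) (TangentSpace 𝓘(ℝ, Eucl n) : N → Type)
      (φ x)).symmL_apply (R := ℝ) (mem_chart_source _ (φ x)) _).symm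
  rw [secondFundForm, h2, map_sub, map_add, tcoord_tvec_self, h1]

end LocalMaps

/-! ### The chain rule of second order -/

section SecondDerivatives

variable {E F G : Type*} [NormedAddCommGroup E] [NormedSpace ℝ E] [NormedAddCommGroup F]
  [NormedSpace ℝ F] [NormedAddCommGroup G] [NormedSpace ℝ G]

theorem ContDiffAt.differentiableAt_fderiv {Φ : E → F} {e : E} (hΦ : ContDiffAt ℝ 2 Φ e) :
    DifferentiableAt ℝ (fderiv ℝ Φ) e :=
  (hΦ.fderiv_right (m := 1) (by norm_num)).differentiableAt one_ne_zero

theorem ContDiffAt.eventually_differentiableAt {Φ : E → F} {e : E} (hΦ : ContDiffAt ℝ 2 Φ e) :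
    ∀ᶠ e' in 𝓝 e, DifferentiableAt ℝ Φ e' :=
  (hΦ.eventually (by simp)).mono fun _ h => h.differentiableAt two_ne_zero

theorem fderiv_fderiv_comp {Ψ : F → G} {Φ : E → F} {e : E} (hΨ : ContDiffAt ℝ 2 Ψ (Φ e))
    (hΦ : ContDiffAt ℝ 2 Φ e) (u v : E) :
    fderiv ℝ (fderiv ℝ (Ψ ∘ Φ)) e u v =
      fderiv ℝ (fderiv ℝ Ψ) (Φ e) (fderiv ℝ Φ e u) (fderiv ℝ Φ e v)
        + fderiv ℝ Ψ (Φ e) (fderiv ℝ (fderiv ℝ Φ) e u v) := by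
  have h1 : fderiv ℝ (Ψ ∘ Φ) =ᶠ[𝓝 e] fun e' => (fderiv ℝ Ψ (Φ e')).comp (fderiv ℝ Φ e') := by
    filter_upwards [hΦ.eventually_differentiableAt,
      hΦ.continuousAt.tendsto.eventually hΨ.eventually_differentiableAt] with e' h h'
    exact fderiv_comp _ h' h
  have h2 := hΦ.differentiableAt two_ne_zero
  have h3 : HasFDerivAt (fun e' => fderiv ℝ Ψ (Φ e'))
      ((fderiv ℝ (fderiv ℝ Ψ) (Φ e)).comp (fderiv ℝ Φ e)) e :=
    hΨ.differentiableAt_fderiv.hasFDerivAt.comp e h2.hasFDerivAt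
  rw [h1.fderiv_eq, (h3.clm_comp hΦ.differentiableAt_fderiv.hasFDerivAt).fderiv]
  simp [add_comm]

end SecondDerivatives

/-! ### Composition of second fundamental forms -/

section Composition

variable {m n k : ℕ} {M N L : Type*} [TopologicalSpace M] [ChartedSpace (Eucl m) M]
  [TopologicalSpace N] [ChartedSpace (Eucl n) N] [TopologicalSpace L] [ChartedSpace (Eucl k) L]

theorem tmap_comp {ψ : N → L} {φ : M → N} {x : M}
    (hψ : MDifferentiableAt 𝓘(ℝ, Eucl n) 𝓘(ℝ, Eucl k) ψ (φ x))
    (hφ : MDifferentiableAt 𝓘(ℝ, Eucl m) 𝓘(ℝ, Eucl n) φ x) (u : TSp m x) :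
    tmap m k (ψ ∘ φ) x u = tmap n k ψ (φ x) (tmap m n φ x u) := by
  have := mfderiv_comp x hψ hφ
  exact congrArg (fun f : TSp m x →L[ℝ] TSp k (ψ (φ x)) => f u) this

variable [IsManifold 𝓘(ℝ, Eucl m) ∞ M] [IsManifold 𝓘(ℝ, Eucl n) ∞ N]
  [IsManifold 𝓘(ℝ, Eucl k) ∞ L]

theorem tcoord_injective (x : M) : Injective (tcoord (m := m) x x) :=
  LeftInverse.injective (tvec_tcoord_self x)

/-- The composition law for second fundamental forms. -/
theorem secondFundForm_comp (g : SymTensor m M) (h : SymTensor n N) (l : SymTensor k L)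
    {ψ : N → L} {φ : M → N} {x : M}
    (hψ : ContMDiffAt 𝓘(ℝ, Eucl n) 𝓘(ℝ, Eucl k) 2 ψ (φ x))
    (hφ : ContMDiffAt 𝓘(ℝ, Eucl m) 𝓘(ℝ, Eucl n) 2 φ x) (u v : TSp m x) :
    secondFundForm g l (ψ ∘ φ) (constField u) (constField v) x =
      tmap n k ψ (φ x) (secondFundForm g h φ (constField u) (constField v) x)
      + secondFundForm h l ψ (constField (tmap m n φ x u)) (constField (tmap m n φ x v)) (φ x) := by
  have hψ1 := hψ.mdifferentiableAt two_ne_zero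
  have hφ1 := hφ.mdifferentiableAt two_ne_zero
  apply tcoord_injective (m := k) (ψ (φ x))
  have h1 := tcoord_secondFundForm g l (hψ.comp x hφ) u v
  rw [map_add, tcoord_tmap_self hψ1, tcoord_secondFundForm g h hφ,
    tcoord_secondFundForm h l hψ]
  refine h1.trans ?_
  have h2 := (localMap_comp (m := m) (n := n) (k := k) ψ hφ.continuousAt)
  have h3 : localMap m k (ψ ∘ φ) x (ψ (φ x)) =ᶠ[𝓝 (chartPt x)]
    localMap n k ψ (φ x) (ψ (φ x)) ∘ localMap m n φ x (φ x) := h2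
  have h4 := (h3.fderiv (𝕜 := ℝ)).fderiv_eq (𝕜 := ℝ)
  have h5 := fderiv_fderiv_comp (Ψ := localMap n k ψ (φ x) (ψ (φ x))) (Φ := localMap m n φ x (φ x))
    (e := chartPt x)
    (by rw [localMap_chartPt]; exact hψ.contDiffAt_localMap) hφ.contDiffAt_localMap
    (tcoord x x u) (tcoord x x v)
  rw [localMap_chartPt, ← tcoord_tmap_self hφ1, ← tcoord_tmap_self hφ1] at h5
  have e1 : ∀ w, tmap m k (ψ ∘ φ) x w = tmap n k ψ (φ x) (tmap m n φ x w) := tmap_comp hψ1 hφ1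
  -- The Koszul term of the middle manifold occurs with both signs and cancels, so no property of
  -- the connections is used, and degenerate metrics with arbitrarily chosen Koszul values are
  -- allowed.
  rw [comp_apply, h4, h5, e1, e1, e1, map_sub, map_add, ← tcoord_tmap_self hψ1,
    ← tcoord_tmap_self hψ1]
  abel

end Composition

/-! ### Non-degenerate forms and duality -/

section Nondegenerate

variable {m : ℕ} {M : Type*} [TopologicalSpace M] [ChartedSpace (Eucl m) M] {g : SymTensor m M}
  {x : M}

/-- `g` is non-degenerate at `x`. -/
def SymTensor.NondegAt (g : SymTensor m M) (x : M) : Prop :=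
  ∀ u, (∀ v, g.form x u v = 0) → u = 0

theorem SymTensor.NondegAt.exists_form_eq (hx : g.NondegAt x) (f : TSp m x →ₗ[ℝ] ℝ) :
    ∃ w, ∀ z, g.form x w z = f z := by
  have hinj : Injective (g.form x : TSp m x →ₗ[ℝ] (TSp m x →ₗ[ℝ] ℝ)) := by
    rw [injective_iff_map_eq_zero]
    intro u hu
    exact hx u fun v => by rw [hu]; rfl
  obtain ⟨w, hw⟩ := (LinearMap.injective_iff_surjective_of_finrank_eq_finrank
    (Subspace.dual_finrank_eq (K := ℝ) (V := TSp m x)).symm).1 hinj f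
  exact ⟨w, fun z => by rw [hw]⟩

theorem SymTensor.NondegAt.ext (hx : g.NondegAt x) {u v : TSp m x}
    (h : ∀ z, g.form x u z = g.form x v z) : u = v := by
  rw [← sub_eq_zero]
  refine hx _ fun z => ?_
  rw [map_sub, LinearMap.sub_apply, h, sub_self]

end Nondegenerate

/-! ### The metric in coordinates and the Koszul formula -/

section Gram

variable {m : ℕ} {M : Type*} [TopologicalSpace M] [ChartedSpace (Eucl m) M]
  [IsManifold 𝓘(ℝ, Eucl m) ∞ M]

/-- The tensor `g` in the coordinates of the chart at `x`. -/
def SymTensor.gram (g : SymTensor m M) (x : M) (e : Eucl m) : Eucl m →L[ℝ] Eucl m →L[ℝ] ℝ :=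
  LinearMap.toContinuousBilinearMap
    ((g.form ((extChartAt 𝓘(ℝ, Eucl m) x).symm e)).compl₁₂
      (tvec x ((extChartAt 𝓘(ℝ, Eucl m) x).symm e)).toLinearMap
      (tvec x ((extChartAt 𝓘(ℝ, Eucl m) x).symm e)).toLinearMap)

theorem SymTensor.gram_apply (g : SymTensor m M) (x : M) (e a b : Eucl m) :
    g.gram x e a b = g.form ((extChartAt 𝓘(ℝ, Eucl m) x).symm e)
      (tvec x ((extChartAt 𝓘(ℝ, Eucl m) x).symm e) a)
      (tvec x ((extChartAt 𝓘(ℝ, Eucl m) x).symm e) b) := rfl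

theorem SymTensor.gram_symm (g : SymTensor m M) (x : M) (e a b : Eucl m) :
    g.gram x e a b = g.gram x e b a := g.symm _ _ _

theorem SymTensor.gram_chart (g : SymTensor m M) {x z : M}
    (hz : z ∈ (chartAt (Eucl m) x).source) (u v : TSp m z) :
    g.gram x (extChartAt 𝓘(ℝ, Eucl m) x z) (tcoord x z u) (tcoord x z v) = g.form z u v := by
  have key : ∀ w, w = z → g.form w (tvec x w (tcoord x z u)) (tvec x w (tcoord x z v)) =
      g.form z u v := by
    rintro w rfl
    rw [tvec_tcoord hz, tvec_tcoord hz]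
  exact key _ ((extChartAt 𝓘(ℝ, Eucl m) x).left_inv (by rwa [extChartAt_source]))

theorem SymTensor.gram_self (g : SymTensor m M) (x : M) (u v : TSp m x) :
    g.gram x (chartPt x) (tcoord x x u) (tcoord x x v) = g.form x u v :=
  g.gram_chart (mem_chart_source _ x) u v

theorem SymTensor.pair_eq_gram (g : SymTensor m M) (x : M) (X Y : VField m M) {e : Eucl m}
    (he : e ∈ (extChartAt 𝓘(ℝ, Eucl m) x).target) :
    g.pair X Y ((extChartAt 𝓘(ℝ, Eucl m) x).symm e) =
      g.gram x e (coordField x X e) (coordField x Y e) := by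
  rw [g.gram_apply, coordField, coordField, tvec_tcoord (chart_symm_mem he),
    tvec_tcoord (chart_symm_mem he)]
  rfl

variable {g : SymTensor m M} {r p q : ℕ}

theorem IsSemiRiemannian.contDiffOn_gram (hg : IsSemiRiemannian g r p q) (x : M) :
    ContDiffOn ℝ ∞ (g.gram x) (extChartAt 𝓘(ℝ, Eucl m) x).target := by
  rw [contDiffOn_clm_apply]
  intro a
  rw [contDiffOn_clm_apply]
  intro b
  have h1 := hg.smooth (chartAt (Eucl m) x).source (constField (tvec x x a))
    (constField (tvec x x b)) (chartAt (Eucl m) x).open_source (smoothFieldOn_constField _)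
    (smoothFieldOn_constField _)
  have h2 := h1.comp (contMDiffOn_extChartAt_symm (I := 𝓘(ℝ, Eucl m)) (n := ∞) x)
    (fun e he => chart_symm_mem he)
  rw [contMDiffOn_iff_contDiffOn] at h2
  refine h2.congr fun e he => ?_
  rw [comp_apply, g.pair_eq_gram x _ _ he, coordField_constField _ he, coordField_constField _ he,
    tcoord_tvec_self, tcoord_tvec_self]

theorem IsSemiRiemannian.contDiffAt_gram (hg : IsSemiRiemannian g r p q) (x : M) :
    ContDiffAt ℝ ∞ (g.gram x) (chartPt x) :=
  (hg.contDiffOn_gram x).contDiffAt (extChartAt_target_mem_nhds x)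

theorem IsSemiRiemannian.eventually_contDiffAt_gram (hg : IsSemiRiemannian g r p q) (x : M) :
    ∀ᶠ e in 𝓝 (chartPt x), ContDiffAt ℝ ∞ (g.gram x) e := by
  filter_upwards [eventually_target x] with e he
  exact (hg.contDiffOn_gram x).contDiffAt (extChartAt_target_mem_nhds' he)

theorem IsSemiRiemannian.fieldDeriv_pair (hg : IsSemiRiemannian g r p q) {x : M}
    (X : VField m M) {Y Z : VField m M} {U : Set M} (hU : IsOpen U) (hx : x ∈ U)
    (hY : SmoothFieldOn Y U) (hZ : SmoothFieldOn Z U) :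
    fieldDeriv X (g.pair Y Z) x =
      fderiv ℝ (g.gram x) (chartPt x) (tcoord x x (X x)) (tcoord x x (Y x)) (tcoord x x (Z x))
      + g.gram x (chartPt x) (fderiv ℝ (coordField x Y) (chartPt x) (tcoord x x (X x)))
          (tcoord x x (Z x))
      + g.gram x (chartPt x) (tcoord x x (Y x))
          (fderiv ℝ (coordField x Z) (chartPt x) (tcoord x x (X x))) := by
  have hd : MDifferentiableAt 𝓘(ℝ, Eucl m) 𝓘(ℝ, ℝ) (g.pair Y Z) x :=
    ((hg.smooth U Y Z hU hY hZ).contMDiffAt (hU.mem_nhds hx)).mdifferentiableAt (by simp)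
  rw [fieldDeriv_eq X hd]
  have h1 : g.pair Y Z ∘ (extChartAt 𝓘(ℝ, Eucl m) x).symm =ᶠ[𝓝 (chartPt x)]
      fun e => g.gram x e (coordField x Y e) (coordField x Z e) := by
    filter_upwards [eventually_target x] with e he
    exact g.pair_eq_gram x Y Z he
  have hG := ((hg.contDiffAt_gram x).differentiableAt (by simp)).hasFDerivAt
  have hY' := ((hY.contDiffAt_coordField (hU.mem_nhds hx)).differentiableAt (by simp)).hasFDerivAt
  have hZ' := ((hZ.contDiffAt_coordField (hU.mem_nhds hx)).differentiableAt (by simp)).hasFDerivAt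
  rw [h1.fderiv_eq, ((hG.clm_apply hY').clm_apply hZ').fderiv, coordField_self, coordField_self]
  simp only [add_apply, ContinuousLinearMap.comp_apply,
    ContinuousLinearMap.flip_apply]
  ring

/-- The Koszul expression `∂_a g(b, c) + ∂_b g(c, a) - ∂_c g(a, b)` for constant vectors in the
chart at `x`. -/
def SymTensor.koszulForm (g : SymTensor m M) (x : M) (a b c : Eucl m) : ℝ :=
  fderiv ℝ (g.gram x) (chartPt x) a b c + fderiv ℝ (g.gram x) (chartPt x) b c a
    - fderiv ℝ (g.gram x) (chartPt x) c a b

theorem fderiv_coordField_constField {x : M} (u : TSp m x) :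
    fderiv ℝ (coordField x (constField u)) (chartPt x) = 0 := by
  have : coordField x (constField u) =ᶠ[𝓝 (chartPt x)] fun _ => tcoord x x u := by
    filter_upwards [eventually_target x] with e he
    exact coordField_constField u he
  rw [this.fderiv_eq, fderiv_fun_const]
  rfl

theorem SymTensor.pair_self (g : SymTensor m M) (X Y : VField m M) (x : M) :
    g.pair X Y x = g.gram x (chartPt x) (tcoord x x (X x)) (tcoord x x (Y x)) :=
  (g.gram_self x _ _).symm

/-- Constant fields have zero derivative, and the derivatives of `Z` from the pairings cancel those
from the brackets. What remains depends on `Z` only through its value at `x`. -/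
theorem IsSemiRiemannian.koszulRHS_eq (hg : IsSemiRiemannian g r p q) {x : M} (u v : TSp m x)
    {Z : VField m M} {U : Set M} (hU : IsOpen U) (hx : x ∈ U) (hZ : SmoothFieldOn Z U) :
    g.koszulRHS (constField u) (constField v) Z x =
      g.koszulForm x (tcoord x x u) (tcoord x x v) (tcoord x x (Z x)) := by
  have hV : IsOpen (U ∩ (chartAt (Eucl m) x).source) := hU.inter (chartAt (Eucl m) x).open_source
  have hxV : x ∈ U ∩ (chartAt (Eucl m) x).source := ⟨hx, mem_chart_source _ x⟩
  have hu := (smoothFieldOn_constField u).mono (inter_subset_right (s := U))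
  have hv := (smoothFieldOn_constField v).mono (inter_subset_right (s := U))
  have hZ' := hZ.mono (inter_subset_left (t := (chartAt (Eucl m) x).source))
  rw [SymTensor.koszulRHS, hg.fieldDeriv_pair _ hV hxV hv hZ', hg.fieldDeriv_pair _ hV hxV hZ' hu,
    hg.fieldDeriv_pair _ hV hxV hu hv, g.pair_self, g.pair_self, g.pair_self,
    tcoord_fieldBracket, tcoord_fieldBracket, tcoord_fieldBracket]
  simp only [fderiv_coordField_constField, constField_self, SymTensor.koszulForm,
    zero_apply, map_zero, sub_zero, zero_sub, map_neg]
  rw [g.gram_symm x (chartPt x) _ (tcoord x x u)]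
  ring

theorem IsSemiRiemannian.isKoszulValue_iff (hg : IsSemiRiemannian g r p q) {x : M}
    (u v w : TSp m x) :
    g.IsKoszulValue (constField u) (constField v) x w ↔
      ∀ z : TSp m x, 2 * g.form x w z =
        g.koszulForm x (tcoord x x u) (tcoord x x v) (tcoord x x z) := by
  constructor
  · intro h z
    have h1 := h _ (constField z) (chartAt (Eucl m) x).open_source (mem_chart_source _ x)
      (smoothFieldOn_constField z)
    rwa [hg.koszulRHS_eq u v (chartAt (Eucl m) x).open_source (mem_chart_source _ x)
      (smoothFieldOn_constField z), constField_self] at h1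
  · intro h U Z hU hx hZ
    rw [hg.koszulRHS_eq u v hU hx hZ, h]

theorem SymTensor.isKoszulValue_koszulDeriv (g : SymTensor m M) {X Y : VField m M} {x : M}
    (h : ∃ w, g.IsKoszulValue X Y x w) : g.IsKoszulValue X Y x (g.koszulDeriv X Y x) := by
  rw [SymTensor.koszulDeriv, dif_pos h]
  exact h.choose_spec

/-- The right hand side is linear in `z`, so non-degeneracy represents it by a vector. Hence
`koszulDeriv` is a true solution and not its default value 0. As solutions are unique, additivity
and homogeneity in `u` and `v` follow below. -/
theorem IsSemiRiemannian.koszulDeriv_spec (hg : IsSemiRiemannian g r p q) {x : M}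
    (hx : g.NondegAt x) (u v z : TSp m x) :
    2 * g.form x (g.koszulDeriv (constField u) (constField v) x) z =
      g.koszulForm x (tcoord x x u) (tcoord x x v) (tcoord x x z) := by
  refine (hg.isKoszulValue_iff u v _).1 (g.isKoszulValue_koszulDeriv ?_) z
  let f : TSp m x →ₗ[ℝ] ℝ :=
    { toFun := fun z => 2⁻¹ * g.koszulForm x (tcoord x x u) (tcoord x x v) (tcoord x x z)
      map_add' := fun a b => by
        simp only [SymTensor.koszulForm, map_add, add_apply]
        ring
      map_smul' := fun c a => by
        simp only [SymTensor.koszulForm, map_smul, smul_apply, smul_eq_mul,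
          RingHom.id_apply]
        ring }
  obtain ⟨w, hw⟩ := hx.exists_form_eq f
  refine ⟨w, (hg.isKoszulValue_iff u v w).2 fun z => ?_⟩
  rw [hw]
  exact mul_inv_cancel_left₀ two_ne_zero _

theorem IsSemiRiemannian.koszulDeriv_add_left (hg : IsSemiRiemannian g r p q) {x : M}
    (hx : g.NondegAt x) (u u' v : TSp m x) :
    g.koszulDeriv (constField (u + u')) (constField v) x =
      g.koszulDeriv (constField u) (constField v) x
        + g.koszulDeriv (constField u') (constField v) x := by
  refine hx.ext fun z => mul_left_cancel₀ (two_ne_zero (α := ℝ)) ?_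
  rw [map_add, LinearMap.add_apply, mul_add, hg.koszulDeriv_spec hx, hg.koszulDeriv_spec hx,
    hg.koszulDeriv_spec hx]
  simp only [SymTensor.koszulForm, map_add, add_apply]
  ring

theorem IsSemiRiemannian.koszulDeriv_smul_left (hg : IsSemiRiemannian g r p q) {x : M}
    (hx : g.NondegAt x) (c : ℝ) (u v : TSp m x) :
    g.koszulDeriv (constField (c • u)) (constField v) x =
      c • g.koszulDeriv (constField u) (constField v) x := by
  refine hx.ext fun z => mul_left_cancel₀ (two_ne_zero (α := ℝ)) ?_
  rw [map_smul, LinearMap.smul_apply, smul_eq_mul, mul_left_comm, hg.koszulDeriv_spec hx,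
    hg.koszulDeriv_spec hx]
  simp only [SymTensor.koszulForm, map_smul, smul_apply, smul_eq_mul]
  ring

theorem IsSemiRiemannian.koszulDeriv_add_right (hg : IsSemiRiemannian g r p q) {x : M}
    (hx : g.NondegAt x) (u v v' : TSp m x) :
    g.koszulDeriv (constField u) (constField (v + v')) x =
      g.koszulDeriv (constField u) (constField v) x
        + g.koszulDeriv (constField u) (constField v') x := by
  refine hx.ext fun z => mul_left_cancel₀ (two_ne_zero (α := ℝ)) ?_
  rw [map_add, LinearMap.add_apply, mul_add, hg.koszulDeriv_spec hx, hg.koszulDeriv_spec hx,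
    hg.koszulDeriv_spec hx]
  simp only [SymTensor.koszulForm, map_add, add_apply]
  ring

theorem IsSemiRiemannian.koszulDeriv_smul_right (hg : IsSemiRiemannian g r p q) {x : M}
    (hx : g.NondegAt x) (c : ℝ) (u v : TSp m x) :
    g.koszulDeriv (constField u) (constField (c • v)) x =
      c • g.koszulDeriv (constField u) (constField v) x := by
  refine hx.ext fun z => mul_left_cancel₀ (two_ne_zero (α := ℝ)) ?_
  rw [map_smul, LinearMap.smul_apply, smul_eq_mul, mul_left_comm, hg.koszulDeriv_spec hx,
    hg.koszulDeriv_spec hx]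
  simp only [SymTensor.koszulForm, map_smul, smul_apply, smul_eq_mul]
  ring

end Gram

/-! ### Metric pullbacks and totally geodesic maps -/

section Pullback

variable {m n : ℕ} {M N : Type*} [TopologicalSpace M] [ChartedSpace (Eucl m) M]
  [TopologicalSpace N] [ChartedSpace (Eucl n) N]
  [IsManifold 𝓘(ℝ, Eucl m) ∞ M] [IsManifold 𝓘(ℝ, Eucl n) ∞ N]
  {g : SymTensor m M} {h : SymTensor n N} {φ : M → N} {r p q r' p' q' : ℕ}

/-- Stated on a neighbourhood so that it can be differentiated. -/
theorem gram_pullback {x : M} (hφ : ContMDiffAt 𝓘(ℝ, Eucl m) 𝓘(ℝ, Eucl n) 2 φ x)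
    (hgh : ∀ z u v, h.form (φ z) (tmap m n φ z u) (tmap m n φ z v) = g.form z u v) :
    ∀ᶠ e in 𝓝 (chartPt x), ∀ a b, g.gram x e a b =
      h.gram (φ x) (localMap m n φ x (φ x) e) (fderiv ℝ (localMap m n φ x (φ x)) e a)
        (fderiv ℝ (localMap m n φ x (φ x)) e b) := by
  filter_upwards [(tendsto_chart_symm (m := m) x).eventually (tcoord_tmap (by norm_num) hφ),
    eventually_target x, (tendsto_chart_symm (m := m) x).eventually
      (hφ.continuousAt.tendsto.eventually (eventually_source (m := n) (φ x)))]
    with e he1 he2 he3 a b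
  have key : ∀ a, fderiv ℝ (localMap m n φ x (φ x)) e a = tcoord (φ x) _ (tmap m n φ _
      (tvec x ((extChartAt 𝓘(ℝ, Eucl m) x).symm e) a)) := by
    intro a
    rw [he1, PartialEquiv.right_inv _ he2, tcoord_tvec (chart_symm_mem he2)]
  rw [g.gram_apply, ← hgh, key, key, ← h.gram_chart he3]
  rfl

theorem fderiv_apply₂ {E F G : Type*} [NormedAddCommGroup E] [NormedSpace ℝ E]
    [NormedAddCommGroup F] [NormedSpace ℝ F] [NormedAddCommGroup G] [NormedSpace ℝ G]
    {B : E → F →L[ℝ] F →L[ℝ] G} {e : E} (hB : DifferentiableAt ℝ B e) (a : E) (b c : F) :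
    fderiv ℝ B e a b c = fderiv ℝ (fun e' => B e' b c) e a := by
  have := ((hB.hasFDerivAt.clm_apply (hasFDerivAt_const b e)).clm_apply
    (hasFDerivAt_const c e)).fderiv
  rw [this]
  simp

theorem fderiv_gram_pullback (hg : IsSemiRiemannian g r p q) (hh : IsSemiRiemannian h r' p' q')
    {x : M} (hφ : ContMDiffAt 𝓘(ℝ, Eucl m) 𝓘(ℝ, Eucl n) 2 φ x)
    (hgh : ∀ z u v, h.form (φ z) (tmap m n φ z u) (tmap m n φ z v) = g.form z u v)
    (a b c : Eucl m) :
    fderiv ℝ (g.gram x) (chartPt x) a b c =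
      fderiv ℝ (h.gram (φ x)) (chartPt (φ x)) (fderiv ℝ (localMap m n φ x (φ x)) (chartPt x) a)
        (fderiv ℝ (localMap m n φ x (φ x)) (chartPt x) b)
        (fderiv ℝ (localMap m n φ x (φ x)) (chartPt x) c)
      + h.gram (φ x) (chartPt (φ x))
          (fderiv ℝ (fderiv ℝ (localMap m n φ x (φ x))) (chartPt x) a b)
          (fderiv ℝ (localMap m n φ x (φ x)) (chartPt x) c)
      + h.gram (φ x) (chartPt (φ x)) (fderiv ℝ (localMap m n φ x (φ x)) (chartPt x) b)
          (fderiv ℝ (fderiv ℝ (localMap m n φ x (φ x))) (chartPt x) a c) := by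
  have hG := (hg.contDiffAt_gram x).differentiableAt (by simp)
  have hH : DifferentiableAt ℝ (h.gram (φ x)) (localMap m n φ x (φ x) (chartPt x)) := by
    rw [localMap_chartPt]
    exact (hh.contDiffAt_gram (φ x)).differentiableAt (by simp)
  have hP := hφ.contDiffAt_localMap
  rw [fderiv_apply₂ hG]
  have h1 : (fun e => g.gram x e b c) =ᶠ[𝓝 (chartPt x)] fun e =>
      h.gram (φ x) (localMap m n φ x (φ x) e) (fderiv ℝ (localMap m n φ x (φ x)) e b)
        (fderiv ℝ (localMap m n φ x (φ x)) e c) :=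
    (gram_pullback hφ hgh).mono fun e he => he b c
  have h2 : HasFDerivAt (fun e => h.gram (φ x) (localMap m n φ x (φ x) e))
      ((fderiv ℝ (h.gram (φ x)) (localMap m n φ x (φ x) (chartPt x))).comp
        (fderiv ℝ (localMap m n φ x (φ x)) (chartPt x))) (chartPt x) :=
    HasFDerivAt.comp (g := h.gram (φ x)) (chartPt x) hH.hasFDerivAt
      (hP.differentiableAt two_ne_zero).hasFDerivAt
  have h3 : ∀ b, HasFDerivAt (fun e => fderiv ℝ (localMap m n φ x (φ x)) e b)
      ((fderiv ℝ (fderiv ℝ (localMap m n φ x (φ x))) (chartPt x)).flip b) (chartPt x) := by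
    intro b
    have := hP.differentiableAt_fderiv.hasFDerivAt.clm_apply (hasFDerivAt_const b (chartPt x))
    rwa [ContinuousLinearMap.comp_zero, zero_add] at this
  rw [h1.fderiv_eq, ((h2.clm_apply (h3 b)).clm_apply (h3 c)).fderiv, localMap_chartPt]
  simp only [add_apply, ContinuousLinearMap.comp_apply, ContinuousLinearMap.flip_apply]
  ring

/-- This is the transformation law of Christoffel symbols. Of the six terms with a second
derivative, symmetry cancels four and makes the other two equal. -/
theorem koszulForm_pullback (hg : IsSemiRiemannian g r p q) (hh : IsSemiRiemannian h r' p' q')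
    {x : M} (hφ : ContMDiffAt 𝓘(ℝ, Eucl m) 𝓘(ℝ, Eucl n) 2 φ x)
    (hgh : ∀ z u v, h.form (φ z) (tmap m n φ z u) (tmap m n φ z v) = g.form z u v)
    (a b c : Eucl m) :
    g.koszulForm x a b c =
      h.koszulForm (φ x) (fderiv ℝ (localMap m n φ x (φ x)) (chartPt x) a)
        (fderiv ℝ (localMap m n φ x (φ x)) (chartPt x) b)
        (fderiv ℝ (localMap m n φ x (φ x)) (chartPt x) c)
      + 2 * h.gram (φ x) (chartPt (φ x))
          (fderiv ℝ (fderiv ℝ (localMap m n φ x (φ x))) (chartPt x) a b)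
          (fderiv ℝ (localMap m n φ x (φ x)) (chartPt x) c) := by
  have hsymm : ∀ a b, fderiv ℝ (fderiv ℝ (localMap m n φ x (φ x))) (chartPt x) a b =
      fderiv ℝ (fderiv ℝ (localMap m n φ x (φ x))) (chartPt x) b a :=
    fun a b => hφ.contDiffAt_localMap.isSymmSndFDerivAt (by simp) a b
  rw [SymTensor.koszulForm, SymTensor.koszulForm, fderiv_gram_pullback hg hh hφ hgh,
    fderiv_gram_pullback hg hh hφ hgh, fderiv_gram_pullback hg hh hφ hgh, hsymm c a, hsymm b a,
    hsymm c b, h.gram_symm _ _ (fderiv ℝ (localMap m n φ x (φ x)) (chartPt x) c)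
      (fderiv ℝ (fderiv ℝ (localMap m n φ x (φ x))) (chartPt x) a b),
    h.gram_symm _ _ (fderiv ℝ (localMap m n φ x (φ x)) (chartPt x) a)
      (fderiv ℝ (fderiv ℝ (localMap m n φ x (φ x))) (chartPt x) b c),
    h.gram_symm _ _ (fderiv ℝ (localMap m n φ x (φ x)) (chartPt x) b)
      (fderiv ℝ (fderiv ℝ (localMap m n φ x (φ x))) (chartPt x) a c)]
  ring

/-- A map with surjective differentials that pulls a non-degenerate metric back to `g` is totally
geodesic. -/
theorem secondFundForm_eq_zero_of_pullback (hg : IsSemiRiemannian g r p q)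
    (hh : IsSemiRiemannian h r' p' q') {x : M}
    (hφ : ContMDiffAt 𝓘(ℝ, Eucl m) 𝓘(ℝ, Eucl n) 2 φ x)
    (hgh : ∀ z u v, h.form (φ z) (tmap m n φ z u) (tmap m n φ z v) = g.form z u v)
    (hnd : h.NondegAt (φ x)) (hsurj : Surjective (tmap m n φ x)) (u v : TSp m x) :
    secondFundForm g h φ (constField u) (constField v) x = 0 := by
  have hφ1 := hφ.mdifferentiableAt two_ne_zero
  set D : TSp n (φ x) := h.koszulDeriv (constField (tmap m n φ x u)) (constField (tmap m n φ x v))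
    (φ x) with hD
  set S : TSp n (φ x) := tvec (φ x) (φ x)
    (fderiv ℝ (fderiv ℝ (localMap m n φ x (φ x))) (chartPt x) (tcoord x x u) (tcoord x x v)) with hS
  -- By the transformation law, `D + S` satisfies the Koszul equation of `g` when tested against
  -- images of vectors `z`.
  have key : ∀ z, 2 * h.form (φ x) (D + S) (tmap m n φ x z) =
      g.koszulForm x (tcoord x x u) (tcoord x x v) (tcoord x x z) := by
    intro z
    rw [koszulForm_pullback hg hh hφ hgh, ← tcoord_tmap_self hφ1, ← tcoord_tmap_self hφ1,
      ← tcoord_tmap_self hφ1, ← hh.koszulDeriv_spec hnd, map_add, LinearMap.add_apply, mul_add,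
      ← h.gram_self (φ x) S, hS, tcoord_tvec_self]
  -- For degenerate `g` a Koszul value need not exist a priori. A lift of `D + S` is one, so the
  -- chosen `koszulDeriv` of `g` solves the equation as well, and its image is forced to be `D + S`.
  obtain ⟨w, hw⟩ := hsurj (D + S)
  have h1 : g.IsKoszulValue (constField u) (constField v) x
      (g.koszulDeriv (constField u) (constField v) x) :=
    g.isKoszulValue_koszulDeriv ⟨w, (hg.isKoszulValue_iff u v w).2 fun z => by
      rw [← hgh, hw, key]⟩
  have h2 := (hg.isKoszulValue_iff u v _).1 h1
  have h3 : tmap m n φ x (g.koszulDeriv (constField u) (constField v) x) = D + S := by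
    refine hnd.ext fun z => ?_
    obtain ⟨z', rfl⟩ := hsurj z
    have := h2 z'
    rw [← hgh, ← key] at this
    exact mul_left_cancel₀ two_ne_zero this
  apply tcoord_injective (m := n) (φ x)
  rw [tcoord_secondFundForm g h hφ, h3, map_add, hS, tcoord_tvec_self, map_zero]
  abel

end Pullback

/-! ### Bilinearity of the second fundamental form -/

section Bilinear

variable {m n : ℕ} {M N : Type*} [TopologicalSpace M] [ChartedSpace (Eucl m) M]
  [TopologicalSpace N] [ChartedSpace (Eucl n) N]
  [IsManifold 𝓘(ℝ, Eucl m) ∞ M] [IsManifold 𝓘(ℝ, Eucl n) ∞ N]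
  {g : SymTensor m M} {h : SymTensor n N} {φ : M → N} {r p q r' p' q' : ℕ}

/-- The second fundamental form at `x` as a bilinear map, for non-degenerate metrics. -/
def secondFundBilin (hg : IsSemiRiemannian g r p q) (hh : IsSemiRiemannian h r' p' q') (x : M)
    (hφ : ContMDiffAt 𝓘(ℝ, Eucl m) 𝓘(ℝ, Eucl n) 2 φ x)
    (hgx : g.NondegAt x) (hhx : h.NondegAt (φ x)) : TSp m x →ₗ[ℝ] TSp m x →ₗ[ℝ] TSp n (φ x) :=
  LinearMap.mk₂ ℝ (fun u v => secondFundForm g h φ (constField u) (constField v) x)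
    (fun u u' v => tcoord_injective (m := n) (φ x) (by
      simp only [map_add, tcoord_secondFundForm g h hφ, hg.koszulDeriv_add_left hgx,
        hh.koszulDeriv_add_left hhx, add_apply]
      abel))
    (fun c u v => tcoord_injective (m := n) (φ x) (by
      simp only [map_smul, tcoord_secondFundForm g h hφ, hg.koszulDeriv_smul_left hgx,
        hh.koszulDeriv_smul_left hhx, smul_apply, smul_add, smul_sub]))
    (fun u v v' => tcoord_injective (m := n) (φ x) (by
      simp only [map_add, tcoord_secondFundForm g h hφ, hg.koszulDeriv_add_right hgx,
        hh.koszulDeriv_add_right hhx]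
      abel))
    (fun c u v => tcoord_injective (m := n) (φ x) (by
      simp only [map_smul, tcoord_secondFundForm g h hφ, hg.koszulDeriv_smul_right hgx,
        hh.koszulDeriv_smul_right hhx, smul_add, smul_sub]))

end Bilinear

/-! ### Invariance of the metric trace -/

section Trace

variable {V W V' W' ι : Type*} [AddCommGroup V] [Module ℝ V] [AddCommGroup W] [Module ℝ W]
  [AddCommGroup V'] [Module ℝ V'] [AddCommGroup W'] [Module ℝ W'] [Fintype ι] [DecidableEq ι]

/-- The sum defining `metricTrace`, for an arbitrary basis. -/
def basisTrace (e : Module.Basis ι ℝ V) (B : LinearMap.BilinForm ℝ V) (T : V → V → W) : W :=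
  ∑ a, ∑ b, (Matrix.of fun i j => B (e i) (e j))⁻¹ a b • T (e a) (e b)

theorem basisTrace_reindex {κ : Type*} [Fintype κ] [DecidableEq κ] (e : Module.Basis ι ℝ V)
    (σ : ι ≃ κ) (B : LinearMap.BilinForm ℝ V) (T : V → V → W) :
    basisTrace (e.reindex σ) B T = basisTrace e B T := by
  have h : (Matrix.of fun i j => B (e.reindex σ i) (e.reindex σ j)) =
      (Matrix.of fun i j => B (e i) (e j)).submatrix σ.symm σ.symm := by
    ext i j
    simp
  unfold basisTrace
  rw [h, Matrix.inv_submatrix_equiv, ← σ.sum_comp]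
  refine Finset.sum_congr rfl fun a _ => ?_
  rw [← σ.sum_comp]
  simp

/-- With $P$ the change of basis, the Gram matrix becomes $P^TGP$, its inverse $P^{-1}G^{-1}P^{-T}$,
and the factors $P$ are absorbed by bilinearity of `T`. The form `B` may be degenerate, since
`Matrix.mul_inv_rev` holds for all square matrices. -/
theorem basisTrace_eq (e f : Module.Basis ι ℝ V) (B : LinearMap.BilinForm ℝ V)
    (T : V →ₗ[ℝ] V →ₗ[ℝ] W) :
    basisTrace f B (fun u v => T u v) = basisTrace e B (fun u v => T u v) := by
  have hP : e.toMatrix f * f.toMatrix e = 1 := e.toMatrix_mul_toMatrix_flip f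
  have hP' : IsUnit (e.toMatrix f).det := Matrix.isUnit_det_of_right_inverse hP
  have hof : ∀ e : Module.Basis ι ℝ V,
      (Matrix.of fun i j => B (e i) (e j)) = LinearMap.BilinForm.toMatrix e B := by
    intro e
    ext i j
    simp [LinearMap.BilinForm.toMatrix_apply]
  have h1 : e.toMatrix f * (LinearMap.BilinForm.toMatrix f B)⁻¹ * (e.toMatrix f).transpose =
      (LinearMap.BilinForm.toMatrix e B)⁻¹ := by
    rw [← LinearMap.BilinForm.toMatrix_mul_basis_toMatrix e f B, Matrix.mul_inv_rev,
      Matrix.mul_inv_rev, ← Matrix.mul_assoc, Matrix.mul_nonsing_inv _ hP', Matrix.one_mul,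
      Matrix.mul_assoc, Matrix.nonsing_inv_mul _ (by rwa [Matrix.det_transpose]), Matrix.mul_one]
  have h2 : ∀ a b, T (f a) (f b) =
      ∑ i, ∑ j, (e.toMatrix f i a * e.toMatrix f j b) • T (e i) (e j) := by
    intro a b
    conv_lhs => rw [← e.sum_toMatrix_smul_self f a, ← e.sum_toMatrix_smul_self f b]
    simp only [map_sum, LinearMap.sum_apply, map_smul, LinearMap.smul_apply, Finset.smul_sum,
      smul_smul]
    rw [Finset.sum_comm]
    simp only [mul_comm]
  unfold basisTrace
  rw [hof, hof, ← h1]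
  simp only [h2, Finset.smul_sum, smul_smul, Matrix.mul_apply, Finset.sum_mul, Finset.sum_smul,
    Matrix.transpose_apply]
  -- Brings the sums into the order in which the entries of $PG^{-1}P^T$ expand.
  have hswap : ∀ F : ι → ι → ι → ι → W,
      ∑ a, ∑ b, ∑ i, ∑ j, F a b i j = ∑ i, ∑ j, ∑ b, ∑ a, F a b i j := by
    intro F
    calc ∑ a, ∑ b, ∑ i, ∑ j, F a b i j = ∑ a, ∑ i, ∑ b, ∑ j, F a b i j :=
          Finset.sum_congr rfl fun a _ => Finset.sum_comm
      _ = ∑ i, ∑ a, ∑ b, ∑ j, F a b i j := Finset.sum_comm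
      _ = ∑ i, ∑ a, ∑ j, ∑ b, F a b i j :=
          Finset.sum_congr rfl fun i _ => Finset.sum_congr rfl fun a _ => Finset.sum_comm
      _ = ∑ i, ∑ j, ∑ a, ∑ b, F a b i j := Finset.sum_congr rfl fun i _ => Finset.sum_comm
      _ = ∑ i, ∑ j, ∑ b, ∑ a, F a b i j :=
          Finset.sum_congr rfl fun i _ => Finset.sum_congr rfl fun j _ => Finset.sum_comm
  rw [hswap]
  refine Finset.sum_congr rfl fun i _ => Finset.sum_congr rfl fun j _ => Finset.sum_congr rfl
    fun b _ => Finset.sum_congr rfl fun a _ => ?_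
  congr 1
  ring

/-- Only `T'` has to be bilinear. This matters because the form upstairs is evaluated on chosen
representatives, and its bilinearity is never established. -/
theorem map_metricTrace [FiniteDimensional ℝ V] [FiniteDimensional ℝ V'] (Ψ : V ≃ₗ[ℝ] V')
    (L : W →ₗ[ℝ] W') (B : LinearMap.BilinForm ℝ V) (B' : LinearMap.BilinForm ℝ V')
    (hB : ∀ u v, B' (Ψ u) (Ψ v) = B u v) (T : V → V → W) (T' : V' →ₗ[ℝ] V' →ₗ[ℝ] W')
    (hT : ∀ u v, L (T u v) = T' (Ψ u) (Ψ v)) :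
    L (metricTrace B T) = metricTrace B' fun u v => T' u v := by
  have h1 : L (metricTrace B T) =
      basisTrace ((Module.finBasis ℝ V).map Ψ) B' fun u v => T' u v := by
    unfold metricTrace basisTrace
    simp only [map_sum, map_smul, hT, Module.Basis.map_apply]
    simp only [hB]
  have h2 : (metricTrace B' fun u v => T' u v) =
      basisTrace (Module.finBasis ℝ V') B' fun u v => T' u v := rfl
  -- The standard bases of `V` and `V'` have different index types, identified through equality of
  -- dimensions.
  rw [h1, h2, ← basisTrace_reindex _ (finCongr Ψ.finrank_eq), basisTrace_eq]

end Trace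

/-! ### Smooth right inverses and sections of kernels -/

section ConstantRank

variable {E F : Type*} [NormedAddCommGroup E] [NormedSpace ℝ E]
  [NormedAddCommGroup F] [NormedSpace ℝ F] [FiniteDimensional ℝ F]

/-- A family of linear maps that is surjective at a point has a family of right inverses near it,
of the same regularity. -/
theorem exists_contDiffAt_rightInverse {D : E → E →L[ℝ] F} {e₀ : E} (hD : ContinuousAt D e₀)
    (hs : Surjective (D e₀)) :
    ∃ R : E → F →L[ℝ] E, ∀ᶠ e in 𝓝 e₀, (∀ w, D e (R e w) = w) ∧
      (ContDiffAt ℝ ∞ D e → ContDiffAt ℝ ∞ R e) := by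
  obtain ⟨R₀, hR₀⟩ := (D e₀).toLinearMap.exists_rightInverse_of_surjective
    (LinearMap.range_eq_top.2 hs)
  let R₁ : F →L[ℝ] E := LinearMap.toContinuousLinearMap R₀
  have hR₁ : (D e₀).comp R₁ = ContinuousLinearMap.id ℝ F := by
    ext w
    exact congrArg (fun f : F →ₗ[ℝ] F => f w) hR₀
  have hc : ContinuousAt (fun e => (D e).comp R₁) e₀ := hD.clm_comp continuousAt_const
  have hinv : ∀ᶠ e in 𝓝 e₀, ((D e).comp R₁).IsInvertible := by
    have := ContinuousLinearEquiv.nhds (ContinuousLinearEquiv.refl ℝ F)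
    have h0 : (D e₀).comp R₁ = (ContinuousLinearEquiv.refl ℝ F : F →L[ℝ] F) := hR₁
    rw [← h0] at this
    exact hc.tendsto.eventually this
  -- A fixed right inverse `R₁` of `D e₀` makes $D_eR_1$ invertible for `e` near `e₀`, so
  -- $R_1(D_eR_1)^{-1}$ corrects it, and inversion is smooth.
  refine ⟨fun e => R₁.comp ((D e).comp R₁).inverse, hinv.mono fun e he => ⟨fun w => ?_, fun h => ?_⟩⟩
  · have := he.self_comp_inverse
    exact congrArg (fun f : F →L[ℝ] F => f w) this
  · exact contDiffAt_const.clm_comp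
      (ContDiffAt.comp (g := ContinuousLinearMap.inverse) e
        (ContinuousLinearMap.IsInvertible.contDiffAt_map_inverse he)
        (h.clm_comp contDiffAt_const))

variable [FiniteDimensional ℝ E]

/-- The kernels of a smooth family of linear maps of constant rank have smooth local sections. -/
theorem exists_contDiffAt_ker_section {T : E → E →L[ℝ] F} {e₀ : E}
    (hT : ∀ᶠ e in 𝓝 e₀, ContDiffAt ℝ ∞ T e) {r : ℕ}
    (hr : ∀ᶠ e in 𝓝 e₀, Module.finrank ℝ (LinearMap.ker (T e).toLinearMap) = r) {u : E}
    (hu : T e₀ u = 0) :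
    ∃ A : E → E, A e₀ = u ∧ ∀ᶠ e in 𝓝 e₀, T e (A e) = 0 ∧ ContDiffAt ℝ ∞ A e := by
  obtain ⟨q₀, hq₀⟩ := (LinearMap.range (T e₀).toLinearMap).subtype.exists_leftInverse_of_injective
    (LinearMap.ker_eq_bot.2 (Submodule.injective_subtype _))
  -- Projecting to the range at `e₀` makes the family surjective there, so that it has smooth right
  -- inverses nearby.
  let q : F →L[ℝ] LinearMap.range (T e₀).toLinearMap := LinearMap.toContinuousLinearMap q₀
  have hq : ∀ w, q (T e₀ w) = ⟨T e₀ w, w, rfl⟩ := fun w =>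
    congrArg (fun f : _ →ₗ[ℝ] _ => f (⟨T e₀ w, w, rfl⟩ : LinearMap.range (T e₀).toLinearMap)) hq₀
  have hD : ∀ᶠ e in 𝓝 e₀, ContDiffAt ℝ ∞ (fun e => q.comp (T e)) e :=
    hT.mono fun e he => contDiffAt_const.clm_comp he
  have hs : Surjective (q.comp (T e₀)) := by
    rintro ⟨_, w, rfl⟩
    exact ⟨w, hq w⟩
  obtain ⟨R, hR⟩ := exists_contDiffAt_rightInverse hD.self_of_nhds.continuousAt hs
  -- Subtracting the correction places `u` in the kernel of `q ∘ T e`; by constant rank this is the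
  -- kernel of `T e`, since one contains the other and the dimensions agree.
  refine ⟨fun e => u - R e (q (T e u)), by simp [hu], ?_⟩
  filter_upwards [hR, hT, hD, hr] with e h1 h2 h3 h4
  refine ⟨?_, contDiffAt_const.sub ((h1.2 h3).clm_apply
    (contDiffAt_const.clm_apply (h2.clm_apply contDiffAt_const)))⟩
  have hle : LinearMap.ker (T e).toLinearMap ≤ LinearMap.ker (q.comp (T e)).toLinearMap := by
    intro w hw
    have : T e w = 0 := hw
    simp [this]
  have hrange : LinearMap.range (q.comp (T e)).toLinearMap = ⊤ :=
    LinearMap.range_eq_top.2 fun w => ⟨R e w, h1.1 w⟩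
  have hdim : Module.finrank ℝ (LinearMap.ker (T e).toLinearMap) =
      Module.finrank ℝ (LinearMap.ker (q.comp (T e)).toLinearMap) := by
    have e1 := (q.comp (T e)).toLinearMap.finrank_range_add_finrank_ker
    have e2 := (T e₀).toLinearMap.finrank_range_add_finrank_ker
    rw [hrange, finrank_top] at e1
    have e3 := hr.self_of_nhds
    omega
  have heq := Submodule.eq_of_le_of_finrank_eq hle hdim
  have hmem : u - R e (q (T e u)) ∈ LinearMap.ker (q.comp (T e)).toLinearMap := by
    have := h1.1 (q (T e u))
    rw [LinearMap.mem_ker, map_sub, sub_eq_zero]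
    exact this.symm
  rw [← heq] at hmem
  exact hmem

end ConstantRank

/-! ### The dimension of the radical -/

section RadicalDim

variable {m : ℕ} {M : Type*} [TopologicalSpace M] [ChartedSpace (Eucl m) M]
  {g : SymTensor m M} {r p q : ℕ}

/-- Pairing `u` with a basis vector returns the coordinate times the diagonal entry, and exactly the
first `r` entries vanish. -/
theorem mem_radical_iff_repr {x : M} (e : Module.Basis (Fin r ⊕ Fin p ⊕ Fin q) ℝ (TSp m x))
    (he : ∀ i j, g.form x (e i) (e j) = if i = j then signEntry r p q i else 0) (u : TSp m x) :
    u ∈ g.radical x ↔ ∀ i, e.repr u (Sum.inr i) = 0 := by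
  have key : ∀ j, g.form x u (e j) = e.repr u j * signEntry r p q j := by
    intro j
    conv_lhs => rw [← e.sum_repr u]
    simp only [map_sum, LinearMap.sum_apply, map_smul, LinearMap.smul_apply, he, smul_eq_mul,
      mul_ite, mul_zero]
    simp
  constructor
  · intro hu i
    have h1 := key (Sum.inr i)
    rw [hu, eq_comm, mul_eq_zero] at h1
    refine h1.resolve_right ?_
    rcases i with i | i <;> simp [signEntry]
  · intro hu v
    have : g.form x u = 0 := by
      refine e.ext fun j => ?_
      rw [key]
      rcases j with j | j
      · simp [signEntry]
      · simp [hu j]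
    rw [this]
    rfl

variable [IsManifold 𝓘(ℝ, Eucl m) ∞ M]

theorem IsSemiRiemannian.finrank_radical (hg : IsSemiRiemannian g r p q) (x : M) :
    Module.finrank ℝ (g.radical x) = r := by
  obtain ⟨e, he⟩ := hg.signature x
  let f : TSp m x →ₗ[ℝ] (Fin p ⊕ Fin q → ℝ) :=
    LinearMap.pi fun i => e.coord (Sum.inr i)
  have hker : LinearMap.ker f = g.radical x := by
    ext u
    rw [mem_radical_iff_repr e he, LinearMap.mem_ker, funext_iff]
    rfl
  have hsurj : LinearMap.range f = ⊤ := by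
    rw [LinearMap.range_eq_top]
    intro c
    refine ⟨∑ i, c i • e (Sum.inr i), funext fun j => ?_⟩
    rcases j with j | j <;> simp [f, Finsupp.single_apply]
  have h1 := f.finrank_range_add_finrank_ker
  rw [hsurj, finrank_top, hker, Module.finrank_eq_card_basis e] at h1
  simp at h1
  omega

theorem IsSemiRiemannian.finrank_ker_gram (hg : IsSemiRiemannian g r p q) (x : M) :
    ∀ᶠ e in 𝓝 (chartPt x), Module.finrank ℝ (LinearMap.ker (g.gram x e).toLinearMap) = r := by
  filter_upwards [eventually_target x] with e he
  have hz := chart_symm_mem he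
  let L : Eucl m ≃ₗ[ℝ] TSp m ((extChartAt 𝓘(ℝ, Eucl m) x).symm e) :=
    { (tvec x ((extChartAt 𝓘(ℝ, Eucl m) x).symm e)).toLinearMap with
      invFun := tcoord x ((extChartAt 𝓘(ℝ, Eucl m) x).symm e)
      left_inv := tcoord_tvec hz
      right_inv := tvec_tcoord hz }
  have h1 : (LinearMap.ker (g.gram x e).toLinearMap).map L.toLinearMap =
      g.radical ((extChartAt 𝓘(ℝ, Eucl m) x).symm e) := by
    ext u
    rw [Submodule.mem_map]
    constructor
    · rintro ⟨a, ha, rfl⟩ v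
      have h2 : g.gram x e a (tcoord x _ v) = 0 :=
        congrArg (fun f : Eucl m →L[ℝ] ℝ => f (tcoord x _ v)) (LinearMap.mem_ker.1 ha)
      rw [g.gram_apply, tvec_tcoord hz] at h2
      exact h2
    · intro hu
      refine ⟨L.symm u, ?_, L.apply_symm_apply u⟩
      rw [LinearMap.mem_ker]
      ext b
      have : tvec x _ (L.symm u) = u := L.apply_symm_apply u
      show g.gram x e (L.symm u) b = 0
      rw [g.gram_apply, this]
      exact hu _
  rw [← hg.finrank_radical, ← h1]
  exact (LinearEquiv.finrank_map_eq L _).symm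

end RadicalDim

theorem SymTensor.leafProj_eq_of_curve {m : ℕ} {M : Type*} [TopologicalSpace M]
    [ChartedSpace (Eucl m) M] {g : SymTensor m M} {x y : M} (h : g.OnRadicalCurve x y) :
    g.leafProj x = g.leafProj y :=
  Quotient.sound (Relation.EqvGen.rel _ _ h)

/-! ### Radical sections, radical curves and the kernel of the projection -/

section RadicalSections

variable {m : ℕ} {M : Type*} [TopologicalSpace M] [ChartedSpace (Eucl m) M]
  [IsManifold 𝓘(ℝ, Eucl m) ∞ M] {g : SymTensor m M} {r p q : ℕ}

theorem tvec_mem_radical {x : M} {e a : Eucl m} (he : e ∈ (extChartAt 𝓘(ℝ, Eucl m) x).target)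
    (ha : g.gram x e a = 0) :
    tvec x ((extChartAt 𝓘(ℝ, Eucl m) x).symm e) a ∈
      g.radical ((extChartAt 𝓘(ℝ, Eucl m) x).symm e) := by
  intro v
  have h2 : g.gram x e a (tcoord x _ v) = 0 := by rw [ha]; rfl
  rwa [g.gram_apply, tvec_tcoord (chart_symm_mem he)] at h2

theorem gram_tcoord_eq_zero {x : M} {u : TSp m x} (hu : u ∈ g.radical x) :
    g.gram x (chartPt x) (tcoord x x u) = 0 := by
  ext b
  rw [← tcoord_tvec_self x b, g.gram_self]
  exact hu _

/-- Every radical vector is the value of a local smooth section of the radical, given in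
coordinates. -/
theorem IsSemiRiemannian.exists_radical_section (hg : IsSemiRiemannian g r p q) {x : M}
    {u : TSp m x} (hu : u ∈ g.radical x) :
    ∃ A : Eucl m → Eucl m, A (chartPt x) = tcoord x x u ∧
      ∀ᶠ e in 𝓝 (chartPt x), g.gram x e (A e) = 0 ∧ ContDiffAt ℝ ∞ A e :=
  exists_contDiffAt_ker_section (hg.eventually_contDiffAt_gram x) (hg.finrank_ker_gram x)
    (gram_tcoord_eq_zero hu)

theorem hasMFDerivAt_chart_symm {x : M} {e : Eucl m}
    (he : e ∈ (extChartAt 𝓘(ℝ, Eucl m) x).target) :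
    HasMFDerivAt 𝓘(ℝ, Eucl m) 𝓘(ℝ, Eucl m) (extChartAt 𝓘(ℝ, Eucl m) x).symm e
      (tvec x ((extChartAt 𝓘(ℝ, Eucl m) x).symm e)) := by
  have h := (mdifferentiableWithinAt_extChartAt_symm (I := 𝓘(ℝ, Eucl m)) he).hasMFDerivWithinAt
  have h1 := tvec_eq_mfderivWithin (chart_symm_mem he)
  rw [PartialEquiv.right_inv _ he] at h1
  rw [← h1] at h
  rw [modelWithCornersSelf_coe, range_id] at h
  exact hasMFDerivWithinAt_univ.1 h

/-- Through every radical vector there is a curve in the leaf. -/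
theorem IsSemiRiemannian.exists_radical_curve (hg : IsSemiRiemannian g r p q) {x : M}
    {u : TSp m x} (hu : u ∈ g.radical x) :
    ∃ y : ℝ → Eucl m, y 0 = chartPt x ∧ HasDerivAt y (tcoord x x u) 0 ∧
      ∀ᶠ t in 𝓝 0, g.OnRadicalCurve x ((extChartAt 𝓘(ℝ, Eucl m) x).symm (y t)) := by
  obtain ⟨A, hA0, hA⟩ := hg.exists_radical_section hu
  -- An integral curve of the radical section `A`, in coordinates. The interval is shrunk below so
  -- that the curve stays in the chart and where `A` is smooth and radical.
  obtain ⟨y, hy0, ε, hε, hy⟩ :=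
    ContDiffAt.exists_forall_mem_closedBall_exists_eq_forall_mem_Ioo_hasDerivAt₀
      (hA.self_of_nhds.2.of_le (by simp) : ContDiffAt ℝ 1 A (chartPt x)) 0
  have hd0 : HasDerivAt y (A (y 0)) 0 := hy 0 (by constructor <;> linarith)
  have hev : ∀ᶠ t in 𝓝 (0 : ℝ), g.gram x (y t) (A (y t)) = 0 ∧ ContDiffAt ℝ ∞ A (y t) ∧
      y t ∈ (extChartAt 𝓘(ℝ, Eucl m) x).target := by
    have hc : Filter.Tendsto y (𝓝 0) (𝓝 (chartPt x)) := hy0 ▸ hd0.continuousAt.tendsto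
    filter_upwards [hc.eventually hA, hc.eventually (eventually_target x)] with t h1 h2
    exact ⟨h1.1, h1.2, h2⟩
  obtain ⟨δ, hδ, hball⟩ := Metric.eventually_nhds_iff_ball.1 hev
  have hη : 0 < min ε δ := lt_min hε hδ
  have hmem : ∀ t ∈ Ioo (-min ε δ) (min ε δ), HasDerivAt y (A (y t)) t ∧
      g.gram x (y t) (A (y t)) = 0 ∧ ContDiffAt ℝ ∞ A (y t) ∧
      y t ∈ (extChartAt 𝓘(ℝ, Eucl m) x).target := by
    intro t ht
    refine ⟨hy t ⟨?_, ?_⟩, hball t ?_⟩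
    · linarith [ht.1, min_le_left ε δ]
    · linarith [ht.2, min_le_left ε δ]
    · rw [Real.ball_eq_Ioo]
      exact ⟨by linarith [ht.1, min_le_right ε δ], by linarith [ht.2, min_le_right ε δ]⟩
  have hyC : ContDiffOn ℝ 1 y (Ioo (-min ε δ) (min ε δ)) := by
    rw [show (1 : WithTop ℕ∞) = 0 + 1 from (zero_add 1).symm,
      contDiffOn_succ_iff_deriv_of_isOpen isOpen_Ioo]
    refine ⟨fun t ht => (hmem t ht).1.differentiableAt.differentiableWithinAt, by simp, ?_⟩
    rw [contDiffOn_zero]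
    have h1 : ContinuousOn (fun t => A (y t)) (Ioo (-min ε δ) (min ε δ)) := fun t ht =>
      ((hmem t ht).2.2.1.continuousAt.comp (hmem t ht).1.continuousAt).continuousWithinAt
    exact h1.congr fun t ht => (hmem t ht).1.deriv
  have hγC : ContMDiffOn 𝓘(ℝ, ℝ) 𝓘(ℝ, Eucl m) 1 ((extChartAt 𝓘(ℝ, Eucl m) x).symm ∘ y)
      (Ioo (-min ε δ) (min ε δ)) :=
    (contMDiffOn_extChartAt_symm (I := 𝓘(ℝ, Eucl m)) (n := 1) x).comp hyC.contMDiffOn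
      fun t ht => (hmem t ht).2.2.2
  refine ⟨y, hy0, hA0 ▸ hy0 ▸ hd0, ?_⟩
  filter_upwards [Ioo_mem_nhds (neg_lt_zero.2 hη) hη] with t ht
  refine ⟨(extChartAt 𝓘(ℝ, Eucl m) x).symm ∘ y, -min ε δ, min ε δ, 0, t,
    ⟨neg_lt_zero.2 hη, hη⟩, ht, hγC, ?_, ?_, rfl⟩
  · intro c hc
    obtain ⟨h1, h2, h3, h4⟩ := hmem c hc
    have h5 := HasMFDerivAt.comp c (hasMFDerivAt_chart_symm h4) h1.hasFDerivAt.hasMFDerivAt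
    rw [h5.mfderiv]
    have h6 := tvec_mem_radical h4 h2
    have h7 : (tvec x ((extChartAt 𝓘(ℝ, Eucl m) x).symm (y c)) ∘L
      (ContinuousLinearMap.toSpanSingleton ℝ (A (y c)))) (1 : ℝ) =
      tvec x ((extChartAt 𝓘(ℝ, Eucl m) x).symm (y c)) (A (y c)) := by
      rw [ContinuousLinearMap.comp_apply, ContinuousLinearMap.toSpanSingleton_apply, one_smul]
    rw [← h7] at h6
    exact h6
  · rw [comp_apply, hy0, extChartAt_to_inv]

variable {k : ℕ} [ChartedSpace (Eucl k) g.LeafSpace] [IsManifold 𝓘(ℝ, Eucl k) ∞ g.LeafSpace]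

/-- The projection is constant on a curve in the leaf with initial velocity `u`, so its derivative
along `u` vanishes. -/
theorem IsSemiRiemannian.radical_le_ker (hg : IsSemiRiemannian g r p q) {x : M}
    (hπ : MDifferentiableAt 𝓘(ℝ, Eucl m) 𝓘(ℝ, Eucl k) g.leafProj x) :
    g.radical x ≤ LinearMap.ker (tmap m k g.leafProj x) := by
  intro u hu
  obtain ⟨y, hy0, hy, hcurve⟩ := hg.exists_radical_curve hu
  rw [LinearMap.mem_ker]
  apply tcoord_injective (m := k) (g.leafProj x)
  rw [tcoord_tmap_self hπ, map_zero]
  have h1 : HasFDerivAt (localMap m k g.leafProj x (g.leafProj x))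
      (fderiv ℝ (localMap m k g.leafProj x (g.leafProj x)) (chartPt x)) (y 0) := by
    rw [hy0]
    exact (hasFDerivAt_localMap hπ (mem_chart_source _ x)
      (mem_chart_source _ _)).differentiableAt.hasFDerivAt
  have h2 := h1.comp_hasDerivAt 0 hy
  have h3 : localMap m k g.leafProj x (g.leafProj x) ∘ y =ᶠ[𝓝 0] fun _ => chartPt (g.leafProj x) := by
    filter_upwards [hcurve] with t ht
    rw [comp_apply, localMap, comp_apply, comp_apply, ← SymTensor.leafProj_eq_of_curve ht]
  have h4 := h3.deriv_eq
  rw [h2.deriv, deriv_const] at h4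
  exact h4

end RadicalSections

/-! ### Local sections of submersions -/

section Submersions

variable {m k : ℕ} {M N : Type*} [TopologicalSpace M] [ChartedSpace (Eucl m) M]
  [TopologicalSpace N] [ChartedSpace (Eucl k) N] {π : M → N}

/-- A submersion has smooth local sections. -/
theorem Manifold.IsSubmersionAt.exists_local_section {x : M}
    (h : Manifold.IsSubmersionAt 𝓘(ℝ, Eucl m) 𝓘(ℝ, Eucl k) ∞ π x) :
    ∃ σ : N → M, ContMDiffAt 𝓘(ℝ, Eucl k) 𝓘(ℝ, Eucl m) ∞ σ (π x) ∧ σ (π x) = x ∧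
      ∀ᶠ y in 𝓝 (π x), π (σ y) = y := by
  set a := h.domChart.extend 𝓘(ℝ, Eucl m) with ha
  set b := h.codChart.extend 𝓘(ℝ, Eucl k) with hb
  have hxa : x ∈ a.source := by
    rw [ha, OpenPartialHomeomorph.extend_source]; exact h.mem_domChart_source
  have hxb : π x ∈ b.source := by
    rw [hb, OpenPartialHomeomorph.extend_source]; exact h.mem_codChart_source
  have hw : EqOn (b ∘ π ∘ a.symm) (Prod.fst ∘ h.equiv) a.target := h.writtenInCharts
  -- In submersion charts the map is the projection to the first factor. The section keeps the
  -- second factor frozen at its value at `x`, so that it passes through `x`.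
  let s : N → Eucl m := fun y => h.equiv.symm (b y, (h.equiv (a x)).2)
  have hsx : s (π x) = a x := by
    have h1 := hw (a.map_source hxa)
    simp only [comp_apply, a.left_inv hxa] at h1
    simp only [s, h1, Prod.mk.eta, ContinuousLinearEquiv.symm_apply_apply]
  have hbC : ContMDiffAt 𝓘(ℝ, Eucl k) 𝓘(ℝ, Eucl k) ∞ b (π x) :=
    h.codChart.contMDiffAt_extend h.codChart_mem_maximalAtlas h.mem_codChart_source
  have hsC : ContMDiffAt 𝓘(ℝ, Eucl k) 𝓘(ℝ, Eucl m) ∞ s (π x) := by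
    have h1 : ContDiff ℝ ∞ (fun w : Eucl k => h.equiv.symm (w, (h.equiv (a x)).2)) :=
      h.equiv.symm.contDiff.comp (contDiff_id.prodMk contDiff_const)
    exact ContMDiffAt.comp (g := fun w : Eucl k => h.equiv.symm (w, (h.equiv (a x)).2)) (f := b)
      (π x) h1.contMDiff.contMDiffAt hbC
  have hta : IsOpen a.target := by
    rw [ha]; exact h.domChart.isOpen_extend_target
  have haC : ContMDiffAt 𝓘(ℝ, Eucl m) 𝓘(ℝ, Eucl m) ∞ a.symm (s (π x)) := by
    rw [hsx]
    exact (contMDiffOn_extend_symm h.domChart_mem_maximalAtlas).contMDiffAt (by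
      rw [← OpenPartialHomeomorph.extend_target']
      exact hta.mem_nhds (a.map_source hxa))
  refine ⟨a.symm ∘ s, haC.comp _ hsC, by rw [comp_apply, hsx, a.left_inv hxa], ?_⟩
  have hev : ∀ᶠ y in 𝓝 (π x), s y ∈ a.target := by
    refine hsC.continuousAt.tendsto.eventually ?_
    rw [hsx]
    exact hta.mem_nhds (a.map_source hxa)
  have hbs : ∀ᶠ y in 𝓝 (π x), y ∈ b.source := by
    rw [hb, OpenPartialHomeomorph.extend_source]
    exact h.codChart.open_source.mem_nhds h.mem_codChart_source
  filter_upwards [hev, hbs] with y hy1 hy2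
  have h1 := hw hy1
  have h2 : a.symm (s y) ∈ a.source := a.map_target hy1
  refine b.injOn ?_ hy2 ?_
  · rw [ha, OpenPartialHomeomorph.extend_source] at h2
    rw [hb, OpenPartialHomeomorph.extend_source]
    exact h.source_subset_preimage_source h2
  · refine h1.trans ?_
    simp [s]

/-- Differentiating $\pi\circ\sigma=\mathrm{id}$ gives a right inverse of the differential. -/
theorem surjective_fderiv_localMap {x : M} {σ : N → M}
    (hπ : ContMDiffAt 𝓘(ℝ, Eucl m) 𝓘(ℝ, Eucl k) 1 π x)
    (hσ : ContMDiffAt 𝓘(ℝ, Eucl k) 𝓘(ℝ, Eucl m) 1 σ (π x)) (hσx : σ (π x) = x)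
    (hsec : ∀ᶠ y in 𝓝 (π x), π (σ y) = y) :
    Surjective (fderiv ℝ (localMap m k π x (π x)) (chartPt x)) := by
  have h1 := hσ.contDiffAt_localMap
  rw [hσx] at h1
  have h0 : localMap k m σ (π x) x (chartPt (π x)) = chartPt x := by
    have := localMap_chartPt (m := k) (n := m) σ (π x)
    rwa [hσx] at this
  have h2 := hπ.contDiffAt_localMap
  have h3 : localMap m k π x (π x) ∘ localMap k m σ (π x) x =ᶠ[𝓝 (chartPt (π x))] id := by
    have hs : ∀ᶠ y in 𝓝 (π x), σ y ∈ (extChartAt 𝓘(ℝ, Eucl m) x).source :=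
      hσ.continuousAt.tendsto.eventually (by
        rw [hσx]; exact extChartAt_source_mem_nhds (I := 𝓘(ℝ, Eucl m)) x)
    filter_upwards [(tendsto_chart_symm (m := k) (π x)).eventually hs,
      (tendsto_chart_symm (m := k) (π x)).eventually hsec, eventually_target (m := k) (π x)]
      with e h1 h2 h3
    simp only [localMap, comp_apply, id]
    rw [PartialEquiv.left_inv _ h1, h2, PartialEquiv.right_inv _ h3]
  intro w
  have h4 := h3.fderiv_eq (𝕜 := ℝ)
  rw [fderiv_id, fderiv_comp _ (by rw [h0]; exact h2.differentiableAt one_ne_zero)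
    (h1.differentiableAt one_ne_zero), h0] at h4
  exact ⟨_, congrArg (fun f : Eucl k →L[ℝ] Eucl k => f w) h4⟩

variable [IsManifold 𝓘(ℝ, Eucl m) ∞ M] [IsManifold 𝓘(ℝ, Eucl k) ∞ N]

theorem Manifold.IsSubmersionAt.surjective_tmap {x : M}
    (h : Manifold.IsSubmersionAt 𝓘(ℝ, Eucl m) 𝓘(ℝ, Eucl k) ∞ π x) :
    Surjective (tmap m k π x) := by
  obtain ⟨σ, hσ, hσx, hsec⟩ := h.exists_local_section
  have hπ : ContMDiffAt 𝓘(ℝ, Eucl m) 𝓘(ℝ, Eucl k) 1 π x := h.contMDiffAt.of_le (by simp)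
  intro w
  obtain ⟨v, hv⟩ := surjective_fderiv_localMap hπ (hσ.of_le (by simp)) hσx hsec
    (tcoord (π x) (π x) w)
  refine ⟨tvec x x v, tcoord_injective (m := k) (π x) ?_⟩
  rw [tcoord_tmap_self (hπ.mdifferentiableAt one_ne_zero), tcoord_tvec_self, hv]

end Submersions

/-! ### The isomorphism between quotient tangent spaces and leaf space tangent spaces -/

section LeafIso

variable {m k : ℕ} {M : Type*} [TopologicalSpace M] [ChartedSpace (Eucl m) M]
  [IsManifold 𝓘(ℝ, Eucl m) ∞ M] {g : SymTensor m M} {r p q : ℕ}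
  [ChartedSpace (Eucl (p + q)) g.LeafSpace] [IsManifold 𝓘(ℝ, Eucl (p + q)) ∞ g.LeafSpace]

theorem leafIso_cls (hg : IsSemiRiemannian g r p q)
    (hπ : Manifold.IsSubmersion 𝓘(ℝ, Eucl m) 𝓘(ℝ, Eucl (p + q)) ∞ g.leafProj) (x : M) (u : TSp m x) :
    g.leafIso (p + q) x (g.cls x u) = tmap m (p + q) g.leafProj x u := by
  have H := hg.radical_le_ker (k := p + q)
    ((hπ.contMDiff x).mdifferentiableAt (by simp) : MDifferentiableAt _ _ g.leafProj x)
  rw [SymTensor.leafIso, dif_pos H]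
  rfl

/-- Surjectivity comes from the submersion, and injectivity from equal dimensions $m-r=p+q$. -/
theorem leafIso_bijective (hg : IsSemiRiemannian g r p q)
    (hπ : Manifold.IsSubmersion 𝓘(ℝ, Eucl m) 𝓘(ℝ, Eucl (p + q)) ∞ g.leafProj)
    (x : M) : Bijective (g.leafIso (p + q) x) := by
  have hsurj : Surjective (g.leafIso (p + q) x) := by
    intro w
    obtain ⟨u, hu⟩ := (hπ.isSubmersionAt x).surjective_tmap w
    exact ⟨g.cls x u, by rw [leafIso_cls hg hπ, hu]⟩
  refine ⟨?_, hsurj⟩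
  rw [LinearMap.injective_iff_surjective_of_finrank_eq_finrank]
  · exact hsurj
  · have h1 : Module.finrank ℝ (g.QT x) + Module.finrank ℝ (g.radical x) =
        Module.finrank ℝ (TSp m x) := (g.radical x).finrank_quotient_add_finrank
    have h2 : Module.finrank ℝ (TSp m x) = m := finrank_euclideanSpace_fin
    have h3 : Module.finrank ℝ (TSp (p + q) (g.leafProj x)) = p + q := finrank_euclideanSpace_fin
    have h4 := hg.dim_eq
    have h5 := hg.finrank_radical x
    rw [h3]
    omega

theorem tmap_leafProj_eq_zero (hg : IsSemiRiemannian g r p q)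
    (hπ : Manifold.IsSubmersion 𝓘(ℝ, Eucl m) 𝓘(ℝ, Eucl (p + q)) ∞ g.leafProj)
    {x : M} {u : TSp m x} (hu : tmap m (p + q) g.leafProj x u = 0) :
    u ∈ g.radical x := by
  rw [← leafIso_cls hg hπ, ← map_zero (g.leafIso (p + q) x)] at hu
  exact (Submodule.Quotient.mk_eq_zero _).1 ((leafIso_bijective hg hπ x).1 hu)

theorem leafForm_tmap (hg : IsSemiRiemannian g r p q)
    (hπ : Manifold.IsSubmersion 𝓘(ℝ, Eucl m) 𝓘(ℝ, Eucl (p + q)) ∞ g.leafProj)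
    (x : M) (u v : TSp m x) :
    g.leafForm (p + q) x (tmap m (p + q) g.leafProj x u) (tmap m (p + q) g.leafProj x v) =
      g.form x u v := by
  have H := leafIso_bijective hg hπ x
  have key : ∀ u, (LinearEquiv.ofBijective _ H).symm (tmap m (p + q) g.leafProj x u) =
      g.cls x u := by
    intro u
    rw [LinearEquiv.symm_apply_eq]
    exact (leafIso_cls hg hπ x u).symm
  rw [SymTensor.leafForm, dif_pos H]
  refine Eq.trans ?_ (g.barForm_cls x u v)
  rw [← key u, ← key v]
  rfl

end LeafIso

/-! ### Stationarity in coordinates -/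

section Stationary

variable {m : ℕ} {M : Type*} [TopologicalSpace M] [ChartedSpace (Eucl m) M]
  [IsManifold 𝓘(ℝ, Eucl m) ∞ M] {g : SymTensor m M} {r p q : ℕ}

/-- `ℒ_A g = 0` in coordinates, for a section `A` of the radical. -/
theorem SymTensor.IsStationary.fderiv_gram (hgs : g.IsStationary)
    (hg : IsSemiRiemannian g r p q) {x : M} {A : Eucl m → Eucl m}
    (hA : ∀ᶠ e in 𝓝 (chartPt x), g.gram x e (A e) = 0 ∧ ContDiffAt ℝ ∞ A e) (b c : Eucl m) :
    fderiv ℝ (g.gram x) (chartPt x) (A (chartPt x)) b c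
      + g.gram x (chartPt x) (fderiv ℝ A (chartPt x) b) c
      + g.gram x (chartPt x) b (fderiv ℝ A (chartPt x) c) = 0 := by
  obtain ⟨V, hV, hVo, hxV⟩ := eventually_nhds_iff.1 hA
  have hUo : IsOpen ((extChartAt 𝓘(ℝ, Eucl m) x).source ∩ extChartAt 𝓘(ℝ, Eucl m) x ⁻¹' V) :=
    (continuousOn_extChartAt x).isOpen_inter_preimage (isOpen_extChartAt_source x) hVo
  have hxU : x ∈ (extChartAt 𝓘(ℝ, Eucl m) x).source ∩ extChartAt 𝓘(ℝ, Eucl m) x ⁻¹' V :=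
    ⟨mem_extChartAt_source x, hxV⟩
  have hUs : (extChartAt 𝓘(ℝ, Eucl m) x).source ∩ extChartAt 𝓘(ℝ, Eucl m) x ⁻¹' V ⊆
      (chartAt (Eucl m) x).source := by
    rw [extChartAt_source]
    exact inter_subset_left
  have hb := (smoothFieldOn_constField (tvec x x b)).mono hUs
  have hc := (smoothFieldOn_constField (tvec x x c)).mono hUs
  have h1 := hgs _ (chartField x A) hUo
    (smoothFieldOn_chartField x hVo fun e he => (hV e he).2.contDiffWithinAt)
    (fun z hz => by
      have h2 := tvec_mem_radical ((extChartAt 𝓘(ℝ, Eucl m) x).map_source hz.1) (hV _ hz.2).1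
      rw [(extChartAt 𝓘(ℝ, Eucl m) x).left_inv hz.1] at h2
      exact h2) _ _ _ hUo subset_rfl hb hc x hxU
  rw [SymTensor.lieDeriv, hg.fieldDeriv_pair _ hUo hxU hb hc, g.pair_self, g.pair_self,
    tcoord_fieldBracket, tcoord_fieldBracket] at h1
  have h3 : coordField x (chartField x A) =ᶠ[𝓝 (chartPt x)] A := by
    filter_upwards [eventually_target x] with e he
    exact coordField_chartField x A he
  -- For a field $b$ constant in the chart, $[A,b]=-DA(b)$, so the bracket terms of the Lie
  -- derivative appear with a plus sign.
  simp only [fderiv_coordField_constField, constField_self, zero_apply, map_zero, zero_sub,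
    map_neg, h3.fderiv_eq, tcoord_tvec_self, chartField_self, neg_apply, sub_neg_eq_add,
    add_zero] at h1
  exact h1

end Stationary

/-! ### Constancy of the metric coefficients along the leaves -/

section Leaf

variable {m : ℕ} {M : Type*} [TopologicalSpace M] [ChartedSpace (Eucl m) M]
  [IsManifold 𝓘(ℝ, Eucl m) ∞ M] {g : SymTensor m M} {r p q : ℕ}
  [ChartedSpace (Eucl (p + q)) g.LeafSpace] [IsManifold 𝓘(ℝ, Eucl (p + q)) ∞ g.LeafSpace]

/-- The projection onto the leaf space in the coordinates of the charts at `x` and its leaf. -/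
abbrev SymTensor.leafLocal (g : SymTensor m M) (k : ℕ) [ChartedSpace (Eucl k) g.LeafSpace]
    (x : M) : Eucl m → Eucl k :=
  localMap m k g.leafProj x (g.leafProj x)

theorem fderiv_leafLocal_eq_zero (hg : IsSemiRiemannian g r p q)
    (hπ : Manifold.IsSubmersion 𝓘(ℝ, Eucl m) 𝓘(ℝ, Eucl (p + q)) ∞ g.leafProj) (x : M) :
    ∀ᶠ e in 𝓝 (chartPt x), ∀ a, g.gram x e a = 0 → fderiv ℝ (g.leafLocal (p + q) x) e a = 0 := by
  filter_upwards [eventually_target x, (tendsto_chart_symm (m := m) x).eventually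
    (tcoord_tmap (by simp) (hπ.contMDiff x))] with e he h1 a ha
  have h2 := h1 (tvec x _ a)
  rw [tcoord_tvec (chart_symm_mem he), (extChartAt 𝓘(ℝ, Eucl m) x).right_inv he] at h2
  rw [← h2, LinearMap.mem_ker.1 (hg.radical_le_ker
    ((hπ.contMDiff _).mdifferentiableAt (by simp)) (tvec_mem_radical he ha)), map_zero]

theorem gram_eq_zero_of_fderiv_leafLocal (hg : IsSemiRiemannian g r p q)
    (hπ : Manifold.IsSubmersion 𝓘(ℝ, Eucl m) 𝓘(ℝ, Eucl (p + q)) ∞ g.leafProj) {x : M} {a : Eucl m}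
    (ha : fderiv ℝ (g.leafLocal (p + q) x) (chartPt x) a = 0) : g.gram x (chartPt x) a = 0 := by
  rw [← tcoord_tvec_self x a] at ha ⊢
  refine gram_tcoord_eq_zero (tmap_leafProj_eq_zero hg hπ
    (tcoord_injective (m := p + q) (g.leafProj x) ?_))
  rw [tcoord_tmap_self ((hπ.contMDiff x).mdifferentiableAt (by simp)), map_zero]
  exact ha

/-- The coefficients of the metric of the leaf space, as functions on `M`, have vanishing
derivative along the leaves. -/
theorem fderiv_gram_rightInverse_eq_zero (hg : IsSemiRiemannian g r p q) (hgs : g.IsStationary)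
    (hπ : Manifold.IsSubmersion 𝓘(ℝ, Eucl m) 𝓘(ℝ, Eucl (p + q)) ∞ g.leafProj) {x : M}
    {R : Eucl m → Eucl (p + q) →L[ℝ] Eucl m} (hRC : ContDiffAt ℝ ∞ R (chartPt x))
    (hR : ∀ᶠ e in 𝓝 (chartPt x), ∀ w, fderiv ℝ (g.leafLocal (p + q) x) e (R e w) = w)
    {u : TSp m x} (hu : u ∈ g.radical x) (α β : Eucl (p + q)) :
    fderiv ℝ (fun e => g.gram x e (R e α) (R e β)) (chartPt x) (tcoord x x u) = 0 := by
  obtain ⟨A, hA0, hA⟩ := hg.exists_radical_section hu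
  have hP : ContDiffAt ℝ 2 (g.leafLocal (p + q) x) (chartPt x) :=
    (hπ.contMDiff x).contDiffAt_localMap.of_le (WithTop.coe_le_coe.2 (le_top (a := (2 : ℕ∞))))
  have hD := hP.differentiableAt_fderiv.hasFDerivAt
  have hA' := (hA.self_of_nhds.2.differentiableAt (by simp)).hasFDerivAt
  have hR' := (hRC.differentiableAt (by simp)).hasFDerivAt
  have hG' := ((hg.contDiffAt_gram x).differentiableAt (by simp)).hasFDerivAt
  have hsymm := hP.isSymmSndFDerivAt (by simp)
  -- The derivative of $d\pi(A)=0$ in the direction `b`.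
  have h1 : ∀ b, fderiv ℝ (fderiv ℝ (g.leafLocal (p + q) x)) (chartPt x) b (tcoord x x u)
      + fderiv ℝ (g.leafLocal (p + q) x) (chartPt x) (fderiv ℝ A (chartPt x) b) = 0 := by
    intro b
    have h2 : (fun e => fderiv ℝ (g.leafLocal (p + q) x) e (A e)) =ᶠ[𝓝 (chartPt x)]
        fun _ => 0 := by
      filter_upwards [hA, fderiv_leafLocal_eq_zero hg hπ x] with e h3 h4
      exact h4 _ h3.1
    have h3 := h2.fderiv_eq (𝕜 := ℝ)
    rw [(hD.clm_apply hA').fderiv, fderiv_fun_const] at h3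
    have h4 := congrArg (fun f : Eucl m →L[ℝ] Eucl (p + q) => f b) h3
    simp only [add_apply, ContinuousLinearMap.comp_apply, ContinuousLinearMap.flip_apply,
      hA0] at h4
    exact (add_comm _ _).trans h4
  -- The derivative of $d\pi(Rw)=w$ in the direction `u`.
  have h2 : ∀ w, fderiv ℝ (fderiv ℝ (g.leafLocal (p + q) x)) (chartPt x) (tcoord x x u)
        (R (chartPt x) w)
      + fderiv ℝ (g.leafLocal (p + q) x) (chartPt x)
        (fderiv ℝ R (chartPt x) (tcoord x x u) w) = 0 := by
    intro w
    have h2 : (fun e => fderiv ℝ (g.leafLocal (p + q) x) e (R e w)) =ᶠ[𝓝 (chartPt x)]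
        fun _ => w := hR.mono fun e he => he w
    have h3 := h2.fderiv_eq (𝕜 := ℝ)
    rw [(hD.clm_apply (hR'.clm_apply (hasFDerivAt_const w _))).fderiv, fderiv_fun_const] at h3
    have h4 := congrArg (fun f : Eucl m →L[ℝ] Eucl (p + q) => f (tcoord x x u)) h3
    simp only [add_apply, ContinuousLinearMap.comp_apply, ContinuousLinearMap.flip_apply,
      zero_apply, map_zero, zero_add] at h4
    exact (add_comm _ _).trans h4
  -- By symmetry of $D^2\pi$, the vectors $(\partial_uR)w$ and $DA(Rw)$ have the same image under
  -- $d\pi$. They differ by a radical vector, so `g` cannot tell them apart; replacing the first by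
  -- the second yields the Lie derivative along `A`.
  have h3 : ∀ w, g.gram x (chartPt x) (fderiv ℝ R (chartPt x) (tcoord x x u) w) =
      g.gram x (chartPt x) (fderiv ℝ A (chartPt x) (R (chartPt x) w)) := by
    intro w
    rw [← sub_eq_zero, ← map_sub]
    refine gram_eq_zero_of_fderiv_leafLocal hg hπ ?_
    have h5 := h1 (R (chartPt x) w)
    rw [hsymm.eq] at h5
    rw [map_sub, sub_eq_zero]
    exact add_left_cancel ((h2 w).trans h5.symm)
  have h4 := hgs.fderiv_gram hg hA (R (chartPt x) α) (R (chartPt x) β)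
  rw [((hG'.clm_apply (hR'.clm_apply (hasFDerivAt_const α _))).clm_apply
    (hR'.clm_apply (hasFDerivAt_const β _))).fderiv]
  simp only [add_apply, ContinuousLinearMap.comp_apply, ContinuousLinearMap.flip_apply,
    zero_apply, map_zero, zero_add]
  rw [hA0] at h4
  rw [h3 α, g.gram_symm x _ (R (chartPt x) α), h3 β, ← g.gram_symm x _ (R (chartPt x) α)]
  linarith

end Leaf

theorem SymTensor.leafProj_surjective {m : ℕ} {M : Type*} [TopologicalSpace M]
    [ChartedSpace (Eucl m) M] (g : SymTensor m M) : Surjective g.leafProj :=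
  Quotient.mk_surjective

/-! ### The metric of the leaf space -/

section LeafMetric

variable {m : ℕ} {M : Type*} [TopologicalSpace M] [ChartedSpace (Eucl m) M]
  {g : SymTensor m M} {r p q : ℕ} [ChartedSpace (Eucl (p + q)) g.LeafSpace]

theorem exists_leafLocal_rightInverse
    (hπ : Manifold.IsSubmersion 𝓘(ℝ, Eucl m) 𝓘(ℝ, Eucl (p + q)) ∞ g.leafProj) (x : M) :
    ∃ R : Eucl m → Eucl (p + q) →L[ℝ] Eucl m, ContDiffAt ℝ ∞ R (chartPt x) ∧
      ∀ᶠ e in 𝓝 (chartPt x), ∀ w, fderiv ℝ (g.leafLocal (p + q) x) e (R e w) = w := by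
  obtain ⟨σ, hσ, hσx, hsec⟩ := (hπ.isSubmersionAt x).exists_local_section
  have hD : ContDiffAt ℝ ∞ (fderiv ℝ (g.leafLocal (p + q) x)) (chartPt x) :=
    (hπ.contMDiff x).contDiffAt_localMap.fderiv_right le_rfl
  obtain ⟨R, hR⟩ := exists_contDiffAt_rightInverse hD.continuousAt
    (surjective_fderiv_localMap ((hπ.contMDiff x).of_le (by simp)) (hσ.of_le (by simp)) hσx hsec)
  exact ⟨R, hR.self_of_nhds.2 hD, hR.mono fun e he => he.1⟩

variable [IsManifold 𝓘(ℝ, Eucl m) ∞ M] [IsManifold 𝓘(ℝ, Eucl (p + q)) ∞ g.LeafSpace]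

/-- The right inverse `R` lifts a tangent vector of the leaf space to `M`, where the induced form is
`g` itself. The form thereby becomes a smooth coordinate expression in the point of `M`. -/
theorem leafForm_eq_gram (hg : IsSemiRiemannian g r p q)
    (hπ : Manifold.IsSubmersion 𝓘(ℝ, Eucl m) 𝓘(ℝ, Eucl (p + q)) ∞ g.leafProj) {x : M}
    {R : Eucl m → Eucl (p + q) →L[ℝ] Eucl m}
    (hR : ∀ᶠ e in 𝓝 (chartPt x), ∀ w, fderiv ℝ (g.leafLocal (p + q) x) e (R e w) = w) :
    ∀ᶠ z in 𝓝 x, ∀ ξ η : TSp (p + q) (g.leafProj z), g.leafForm (p + q) z ξ η =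
      g.gram x (extChartAt 𝓘(ℝ, Eucl m) x z)
        (R (extChartAt 𝓘(ℝ, Eucl m) x z) (tcoord (g.leafProj x) (g.leafProj z) ξ))
        (R (extChartAt 𝓘(ℝ, Eucl m) x z) (tcoord (g.leafProj x) (g.leafProj z) η)) := by
  filter_upwards [eventually_source (m := m) x,
    (hπ.contMDiff x).continuousAt.tendsto.eventually (eventually_source (m := p + q) (g.leafProj x)),
    (continuousAt_extChartAt (I := 𝓘(ℝ, Eucl m)) x).tendsto.eventually hR,
    tcoord_tmap (by simp) (hπ.contMDiff x)] with z hz hπz hRz hT ξ η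
  have key : ∀ ξ : TSp (p + q) (g.leafProj z), tmap m (p + q) g.leafProj z
      (tvec x z (R (extChartAt 𝓘(ℝ, Eucl m) x z) (tcoord (g.leafProj x) (g.leafProj z) ξ))) =
        ξ := by
    intro ξ
    rw [← tvec_tcoord hπz (tmap m (p + q) g.leafProj z _), hT, tcoord_tvec hz]
    exact (congrArg _ (hRz _)).trans (tvec_tcoord hπz ξ)
  conv_lhs => rw [← key ξ, ← key η]
  rw [leafForm_tmap hg hπ, ← g.gram_chart hz, tcoord_tvec hz, tcoord_tvec hz]

theorem tcoord_tvec_of_eq {k : ℕ} {L : Type*} [TopologicalSpace L] [ChartedSpace (Eucl k) L]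
    [IsManifold 𝓘(ℝ, Eucl k) ∞ L] {y z : L} (h : z = y) (α : Eucl k) :
    tcoord y z (tvec z z α) = α := by
  subst h
  exact tcoord_tvec_self z α

theorem hasDerivAt_extChartAt_comp {γ : ℝ → M} {c : ℝ} {x : M}
    (hγ : MDifferentiableAt 𝓘(ℝ, ℝ) 𝓘(ℝ, Eucl m) γ c) (hx : γ c ∈ (chartAt (Eucl m) x).source) :
    HasDerivAt (fun t => extChartAt 𝓘(ℝ, Eucl m) x (γ t))
      (tcoord x (γ c) (mfderiv 𝓘(ℝ, ℝ) 𝓘(ℝ, Eucl m) γ c (1 : ℝ))) c := by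
  have h1 := (mdifferentiableAt_extChartAt (I := 𝓘(ℝ, Eucl m)) hx).hasMFDerivAt
  rw [← tcoord_eq_mfderiv hx] at h1
  have h2 : HasFDerivAt (fun t => extChartAt 𝓘(ℝ, Eucl m) x (γ t))
      (show ℝ →L[ℝ] Eucl m from tcoord x (γ c) ∘L mfderiv 𝓘(ℝ, ℝ) 𝓘(ℝ, Eucl m) γ c) c :=
    (HasMFDerivAt.comp c h1 hγ.hasMFDerivAt).hasFDerivAt
  exact h2.hasDerivAt

/-- The form induced on the tangent space of the leaf space does not depend on the point of the
leaf. -/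
theorem leafForm_tvec_eq_of_leafSetoid (hg : IsSemiRiemannian g r p q) (hgs : g.IsStationary)
    (hπ : Manifold.IsSubmersion 𝓘(ℝ, Eucl m) 𝓘(ℝ, Eucl (p + q)) ∞ g.leafProj) {x y : M}
    (hxy : g.leafSetoid x y) (α β : Eucl (p + q)) :
    g.leafForm (p + q) x (tvec (g.leafProj x) (g.leafProj x) α)
        (tvec (g.leafProj x) (g.leafProj x) β) =
      g.leafForm (p + q) y (tvec (g.leafProj y) (g.leafProj y) α)
        (tvec (g.leafProj y) (g.leafProj y) β) := by
  induction hxy with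
  | refl x => rfl
  | symm x y _ ih => exact ih.symm
  | trans x y z _ _ ih1 ih2 => exact ih1.trans ih2
  | rel x y hxy =>
    obtain ⟨γ, a, b, s, t, hs, ht, hγ, hrad, rfl, rfl⟩ := hxy
    let f : ℝ → ℝ := fun c => g.leafForm (p + q) (γ c)
      (tvec (g.leafProj (γ c)) (g.leafProj (γ c)) α) (tvec (g.leafProj (γ c)) (g.leafProj (γ c)) β)
    have hf : ∀ c ∈ Ioo a b, HasDerivAt f 0 c := by
      intro c hc
      have hγc : MDifferentiableAt 𝓘(ℝ, ℝ) 𝓘(ℝ, Eucl m) γ c :=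
        ((hγ c hc).contMDiffAt (isOpen_Ioo.mem_nhds hc)).mdifferentiableAt one_ne_zero
      obtain ⟨R, hRC, hR⟩ := exists_leafLocal_rightInverse hπ (γ c)
      have hF : HasFDerivAt (fun e => g.gram (γ c) e (R e α) (R e β)) _ (chartPt (γ c)) :=
        ((((hg.contDiffAt_gram (γ c)).clm_apply (hRC.clm_apply contDiffAt_const)).clm_apply
          (hRC.clm_apply contDiffAt_const)).differentiableAt (by simp)).hasFDerivAt
      have h1 := HasFDerivAt.comp_hasDerivAt c hF
        (hasDerivAt_extChartAt_comp hγc (mem_chart_source (Eucl m) (γ c)))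
      have h0 := fderiv_gram_rightInverse_eq_zero hg hgs hπ hRC hR (hrad c hc) α β
      rw [h0] at h1
      refine h1.congr_of_eventuallyEq ?_
      filter_upwards [isOpen_Ioo.mem_nhds hc,
        hγc.continuousAt.tendsto.eventually (leafForm_eq_gram hg hπ hR)] with c' hc' h2
      -- The whole curve lies over one point of the leaf space, so the vectors with coordinates `α`,
      -- `β` in the chart at that point do not vary with the parameter.
      have h3 : g.leafProj (γ c') = g.leafProj (γ c) :=
        SymTensor.leafProj_eq_of_curve ⟨γ, a, b, c', c, hc', hc, hγ, hrad, rfl, rfl⟩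
      simp only [f, h2, tcoord_tvec_of_eq h3, comp_apply]
    exact isOpen_Ioo.is_const_of_deriv_eq_zero isPreconnected_Ioo
      (fun c hc => (hf c hc).differentiableAt.differentiableWithinAt)
      (fun c hc => (hf c hc).deriv) hs ht

/-- The metric is defined at the representative `Quotient.out` and transported along an equality of
leaves. Coordinates in the chart at the leaf are compatible with this transport, and independence of
the representative does the rest. -/
theorem leafMetric_form (hg : IsSemiRiemannian g r p q) (hgs : g.IsStationary)
    (hπ : Manifold.IsSubmersion 𝓘(ℝ, Eucl m) 𝓘(ℝ, Eucl (p + q)) ∞ g.leafProj) (x : M)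
    (ξ η : TSp (p + q) (g.leafProj x)) :
    (g.leafMetric (p + q)).form (g.leafProj x) ξ η = g.leafForm (p + q) x ξ η := by
  have key : ∀ (z z' : g.LeafSpace) (e : z = z') (B : LinearMap.BilinForm ℝ (TSp (p + q) z))
      (α β : Eucl (p + q)),
      (e ▸ B : LinearMap.BilinForm ℝ (TSp (p + q) z')) (tvec z' z' α) (tvec z' z' β) =
        B (tvec z z α) (tvec z z β) := by
    rintro z _ rfl B α β
    rfl
  rw [← tvec_tcoord_self _ ξ, ← tvec_tcoord_self _ η,
    ← leafForm_tvec_eq_of_leafSetoid hg hgs hπ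
      (Quotient.exact (Quotient.out_eq (g.leafProj x)))]
  exact key _ _ (g.leafProj_out _) _ _ _

theorem leafMetric_form_tmap (hg : IsSemiRiemannian g r p q) (hgs : g.IsStationary)
    (hπ : Manifold.IsSubmersion 𝓘(ℝ, Eucl m) 𝓘(ℝ, Eucl (p + q)) ∞ g.leafProj) (x : M)
    (u v : TSp m x) :
    (g.leafMetric (p + q)).form (g.leafProj x) (tmap m (p + q) g.leafProj x u)
      (tmap m (p + q) g.leafProj x v) = g.form x u v := by
  rw [leafMetric_form hg hgs hπ, leafForm_tmap hg hπ]

/-- Near the leaf of `x`, evaluating the coordinate expression of the form along a local section `σ`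
exhibits the pairing as a composition of smooth maps. -/
theorem contMDiffAt_leafMetric_pair (hg : IsSemiRiemannian g r p q) (hgs : g.IsStationary)
    (hπ : Manifold.IsSubmersion 𝓘(ℝ, Eucl m) 𝓘(ℝ, Eucl (p + q)) ∞ g.leafProj) {x : M}
    {U : Set g.LeafSpace} {X Y : VField (p + q) g.LeafSpace} (hU : U ∈ 𝓝 (g.leafProj x))
    (hX : SmoothFieldOn X U) (hY : SmoothFieldOn Y U) :
    ContMDiffAt 𝓘(ℝ, Eucl (p + q)) 𝓘(ℝ, ℝ) ∞ ((g.leafMetric (p + q)).pair X Y)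
      (g.leafProj x) := by
  obtain ⟨σ, hσ, hσx, hsec⟩ := (hπ.isSubmersionAt x).exists_local_section
  obtain ⟨R, hRC, hR⟩ := exists_leafLocal_rightInverse hπ x
  have hc : ContMDiffAt 𝓘(ℝ, Eucl (p + q)) 𝓘(ℝ, Eucl m) ∞
      (fun y => extChartAt 𝓘(ℝ, Eucl m) x (σ y)) (g.leafProj x) :=
    ContMDiffAt.comp (g := extChartAt 𝓘(ℝ, Eucl m) x) (g.leafProj x)
      (hσx.symm ▸ contMDiffAt_extChartAt) hσ
  have hcx : extChartAt 𝓘(ℝ, Eucl m) x (σ (g.leafProj x)) = chartPt x := by rw [hσx]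
  have hG' : ContMDiffAt 𝓘(ℝ, Eucl (p + q)) _ ∞
      (fun y => g.gram x (extChartAt 𝓘(ℝ, Eucl m) x (σ y))) (g.leafProj x) :=
    ContMDiffAt.comp (g := g.gram x) (f := fun y => extChartAt 𝓘(ℝ, Eucl m) x (σ y)) (g.leafProj x)
      (hcx.symm ▸ hg.contDiffAt_gram x).contMDiffAt hc
  have hR' : ContMDiffAt 𝓘(ℝ, Eucl (p + q)) _ ∞
      (fun y => R (extChartAt 𝓘(ℝ, Eucl m) x (σ y))) (g.leafProj x) :=
    ContMDiffAt.comp (g := R) (f := fun y => extChartAt 𝓘(ℝ, Eucl m) x (σ y)) (g.leafProj x)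
      (hcx.symm ▸ hRC).contMDiffAt hc
  have hfield : ∀ Z : VField (p + q) g.LeafSpace, SmoothFieldOn Z U →
      ContMDiffAt 𝓘(ℝ, Eucl (p + q)) 𝓘(ℝ, Eucl (p + q)) ∞
        (fun y => coordField (g.leafProj x) Z (extChartAt 𝓘(ℝ, Eucl (p + q)) (g.leafProj x) y))
        (g.leafProj x) := fun Z hZ =>
    ContMDiffAt.comp (g := coordField (g.leafProj x) Z) (g.leafProj x)
      (hZ.contDiffAt_coordField hU).contMDiffAt contMDiffAt_extChartAt
  refine ((hG'.clm_apply (hR'.clm_apply (hfield X hX))).clm_apply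
    (hR'.clm_apply (hfield Y hY))).congr_of_eventuallyEq ?_
  have hev := leafForm_eq_gram hg hπ hR
  rw [← hσx] at hev
  filter_upwards [hσ.continuousAt.tendsto.eventually hev, hsec,
    eventually_source (m := p + q) (g.leafProj x)] with y h1 h2 h3
  rw [hσx] at h1
  have h4 : ∀ y' (e : g.leafProj (σ y) = y') (ξ η : TSp (p + q) y'),
      (g.leafMetric (p + q)).form y' ξ η = g.gram x (extChartAt 𝓘(ℝ, Eucl m) x (σ y))
        (R (extChartAt 𝓘(ℝ, Eucl m) x (σ y)) (tcoord (g.leafProj x) y' ξ))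
        (R (extChartAt 𝓘(ℝ, Eucl m) x (σ y)) (tcoord (g.leafProj x) y' η)) := by
    rintro _ rfl ξ η
    rw [leafMetric_form hg hgs hπ, h1]
  have h5 : ∀ Z : VField (p + q) g.LeafSpace, coordField (g.leafProj x) Z
      (extChartAt 𝓘(ℝ, Eucl (p + q)) (g.leafProj x) y) = tcoord (g.leafProj x) y (Z y) := by
    intro Z
    rw [coordField, (extChartAt 𝓘(ℝ, Eucl (p + q)) (g.leafProj x)).left_inv
      (by rwa [extChartAt_source])]
  rw [h5, h5]
  exact h4 y h2 _ _

theorem isSemiRiemannian_leafMetric (hg : IsSemiRiemannian g r p q) (hgs : g.IsStationary)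
    (hπ : Manifold.IsSubmersion 𝓘(ℝ, Eucl m) 𝓘(ℝ, Eucl (p + q)) ∞ g.leafProj) :
    IsSemiRiemannian (g.leafMetric (p + q)) 0 p q where
  dim_eq := by omega
  smooth U X Y hU hX hY y hy := by
    obtain ⟨x, rfl⟩ := g.leafProj_surjective y
    exact (contMDiffAt_leafMetric_pair hg hgs hπ (hU.mem_nhds hy) hX hY).contMDiffWithinAt
  signature y := by
    obtain ⟨x, rfl⟩ := g.leafProj_surjective y
    obtain ⟨e, he⟩ := hg.signature x
    -- The images of the non-null vectors of an adapted basis. They are orthogonal with squares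
    -- $\pm1$, hence independent, and there are $p+q$ of them.
    let b : Fin 0 ⊕ Fin p ⊕ Fin q → TSp (p + q) (g.leafProj x) := fun i =>
      tmap m (p + q) g.leafProj x (e (Sum.map Fin.elim0 id i))
    have hb : ∀ i j, (g.leafMetric (p + q)).form (g.leafProj x) (b i) (b j) =
        if i = j then signEntry 0 p q i else 0 := by
      intro i j
      rw [leafMetric_form_tmap hg hgs hπ, he]
      rcases i with i | i
      · exact i.elim0
      rcases j with j | j
      · exact j.elim0
      simp [signEntry]
    have hli : LinearIndependent ℝ b := by
      rw [Fintype.linearIndependent_iff]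
      intro c hc i
      have h1 := congrArg (fun ξ => (g.leafMetric (p + q)).form (g.leafProj x) ξ (b i)) hc
      simp only [map_sum, LinearMap.sum_apply, map_smul, LinearMap.smul_apply, hb, smul_eq_mul,
        mul_ite, mul_zero, Finset.sum_ite_eq', Finset.mem_univ, if_true, map_zero,
        LinearMap.zero_apply] at h1
      refine (mul_eq_zero.1 h1).resolve_right ?_
      rcases i with i | i | i
      · exact i.elim0
      all_goals simp [signEntry]
    have hcard : Fintype.card (Fin 0 ⊕ Fin p ⊕ Fin q) =
        Module.finrank ℝ (TSp (p + q) (g.leafProj x)) := by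
      rw [show Module.finrank ℝ (TSp (p + q) (g.leafProj x)) = p + q from
        finrank_euclideanSpace_fin]
      simp
    refine ⟨Module.Basis.mk hli (hli.span_eq_top_of_card_eq_finrank' hcard).ge, fun i j => ?_⟩
    rw [Module.Basis.mk_apply, Module.Basis.mk_apply]
    exact hb i j

end LeafMetric

theorem IsSemiRiemannian.nondegAt {m p q : ℕ} {M : Type*} [TopologicalSpace M]
    [ChartedSpace (Eucl m) M] [IsManifold 𝓘(ℝ, Eucl m) ∞ M] {g : SymTensor m M}
    (hg : IsSemiRiemannian g 0 p q) (x : M) : g.NondegAt x := by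
  obtain ⟨e, he⟩ := hg.signature x
  intro u hu
  have h1 := (mem_radical_iff_repr e he u).1 hu
  refine e.ext_elem fun i => ?_
  rcases i with i | i
  · exact i.elim0
  · rw [h1, map_zero, Finsupp.zero_apply]

/-! ### The induced map and its tension field -/

section LeafMap

variable {m n r p q ρ p' q' : ℕ} {M N : Type*}
  [TopologicalSpace M] [ChartedSpace (Eucl m) M] [TopologicalSpace N] [ChartedSpace (Eucl n) N]
  {g : SymTensor m M} {h : SymTensor n N} [ChartedSpace (Eucl (p + q)) g.LeafSpace]
  [ChartedSpace (Eucl (p' + q')) h.LeafSpace] {φ : M → N}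

/-- With a local section `σ` of $\pi_M$, the induced map is locally $\pi_N\circ\phi\circ\sigma$. -/
theorem contMDiff_leafMap
    (hπM : Manifold.IsSubmersion 𝓘(ℝ, Eucl m) 𝓘(ℝ, Eucl (p + q)) ∞ g.leafProj)
    (hπN : Manifold.IsSubmersion 𝓘(ℝ, Eucl n) 𝓘(ℝ, Eucl (p' + q')) ∞ h.leafProj)
    (hC : ContMDiff 𝓘(ℝ, Eucl m) 𝓘(ℝ, Eucl n) 2 φ) (hφ : RadicalPreserving g h φ) :
    ContMDiff 𝓘(ℝ, Eucl (p + q)) 𝓘(ℝ, Eucl (p' + q')) 2 (leafMap hφ hC) := by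
  intro y
  obtain ⟨x, rfl⟩ := g.leafProj_surjective y
  obtain ⟨σ, hσ, -, hsec⟩ := (hπM.isSubmersionAt x).exists_local_section
  have h2 : (2 : WithTop ℕ∞) ≤ ∞ := WithTop.coe_le_coe.2 (le_top (a := (2 : ℕ∞)))
  have h1 : ContMDiffAt 𝓘(ℝ, Eucl (p + q)) 𝓘(ℝ, Eucl (p' + q')) 2 (h.leafProj ∘ φ ∘ σ)
      (g.leafProj x) :=
    ((hπN.contMDiff _).of_le h2).comp _ ((hC _).comp _ (hσ.of_le h2))
  refine h1.congr_of_eventuallyEq ?_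
  filter_upwards [hsec] with y hy
  exact (congrArg (leafMap hφ hC) hy).symm

variable [IsManifold 𝓘(ℝ, Eucl m) ∞ M] [IsManifold 𝓘(ℝ, Eucl n) ∞ N]
  [IsManifold 𝓘(ℝ, Eucl (p + q)) ∞ g.LeafSpace] [IsManifold 𝓘(ℝ, Eucl (p' + q')) ∞ h.LeafSpace]

/-- The second fundamental form of a radical-preserving map projects onto that of the induced map
of the leaf spaces. -/
theorem tmap_leafProj_secondFundForm (hg : IsSemiRiemannian g r p q) (hgs : g.IsStationary)
    (hh : IsSemiRiemannian h ρ p' q') (hhs : h.IsStationary)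
    (hπM : Manifold.IsSubmersion 𝓘(ℝ, Eucl m) 𝓘(ℝ, Eucl (p + q)) ∞ g.leafProj)
    (hπN : Manifold.IsSubmersion 𝓘(ℝ, Eucl n) 𝓘(ℝ, Eucl (p' + q')) ∞ h.leafProj)
    (hC : ContMDiff 𝓘(ℝ, Eucl m) 𝓘(ℝ, Eucl n) 2 φ) (hφ : RadicalPreserving g h φ)
    (x : M) (u v : TSp m x) :
    tmap n (p' + q') h.leafProj (φ x) (secondFundForm g h φ (constField u) (constField v) x) =
      secondFundForm (g.leafMetric (p + q)) (h.leafMetric (p' + q')) (leafMap hφ hC)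
        (constField (tmap m (p + q) g.leafProj x u)) (constField (tmap m (p + q) g.leafProj x v))
        (g.leafProj x) := by
  have h2 : (2 : WithTop ℕ∞) ≤ ∞ := WithTop.coe_le_coe.2 (le_top (a := (2 : ℕ∞)))
  have hπM2 := (hπM.contMDiff x).of_le h2
  have hπN2 := (hπN.contMDiff (φ x)).of_le h2
  have hlM := isSemiRiemannian_leafMetric hg hgs hπM
  have hlN := isSemiRiemannian_leafMetric hh hhs hπN
  have hA := secondFundForm_comp g h (h.leafMetric (p' + q')) hπN2 (hC x) u v
  have hB := secondFundForm_comp g (g.leafMetric (p + q)) (h.leafMetric (p' + q'))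
    (contMDiff_leafMap hπM hπN hC hφ (g.leafProj x)) hπM2 u v
  rw [secondFundForm_eq_zero_of_pullback hh hlN hπN2 (leafMetric_form_tmap hh hhs hπN)
    (hlN.nondegAt _) (hπN.isSubmersionAt (φ x)).surjective_tmap, add_zero] at hA
  rw [secondFundForm_eq_zero_of_pullback hg hlM hπM2 (leafMetric_form_tmap hg hgs hπM)
    (hlM.nondegAt _) (hπM.isSubmersionAt x).surjective_tmap, map_zero, zero_add] at hB
  -- Both sides compute the second fundamental form of one map, as $\pi_N\circ\phi$ and
  -- $\overline\phi\circ\pi_M$ agree by definition of the quotient map.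
  exact hA.symm.trans hB

/-- Passing to classes is linear, so the generalized form is the class of the form built from the
chosen Koszul values, to which the composition law applies. -/
theorem genSecondFundForm_eq (hφ : RadicalPreserving g h φ) (X Y : VField m M) (x : M) :
    genSecondFundForm hφ X Y x = h.cls (φ x) (secondFundForm g h φ X Y x) :=
  (map_sub (h.cls (φ x)) _ _).symm

theorem leafIso_genTensionField (hg : IsSemiRiemannian g r p q) (hgs : g.IsStationary)
    (hh : IsSemiRiemannian h ρ p' q') (hhs : h.IsStationary)
    (hπM : Manifold.IsSubmersion 𝓘(ℝ, Eucl m) 𝓘(ℝ, Eucl (p + q)) ∞ g.leafProj)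
    (hπN : Manifold.IsSubmersion 𝓘(ℝ, Eucl n) 𝓘(ℝ, Eucl (p' + q')) ∞ h.leafProj)
    (hC : ContMDiff 𝓘(ℝ, Eucl m) 𝓘(ℝ, Eucl n) 2 φ) (hφ : RadicalPreserving g h φ) (x : M) :
    h.leafIso (p' + q') (φ x) (genTensionField hφ x) =
      tensionField (g.leafMetric (p + q)) (h.leafMetric (p' + q')) (leafMap hφ hC)
        (g.leafProj x) := by
  have hlM := isSemiRiemannian_leafMetric hg hgs hπM
  have hlN := isSemiRiemannian_leafMetric hh hhs hπN
  have hΨ : ∀ ξ : g.QT x, LinearEquiv.ofBijective _ (leafIso_bijective hg hπM x) ξ =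
      tmap m (p + q) g.leafProj x (g.rep x ξ) := by
    intro ξ
    rw [← leafIso_cls hg hπM, g.cls_rep]
    rfl
  -- Traces are compared along the isometry $\Psi^M$, with bilinearity supplied by the form on the
  -- leaf space, where both metrics are non-degenerate.
  refine map_metricTrace (LinearEquiv.ofBijective _ (leafIso_bijective hg hπM x))
    (h.leafIso (p' + q') (φ x)) (g.barForm x) ((g.leafMetric (p + q)).form (g.leafProj x))
    (fun ξ η => ?_) _ (secondFundBilin hlM hlN (g.leafProj x)
      (contMDiff_leafMap hπM hπN hC hφ (g.leafProj x)) (hlM.nondegAt _) (hlN.nondegAt _))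
    (fun ξ η => ?_)
  · rw [hΨ, hΨ, leafMetric_form_tmap hg hgs hπM, ← g.barForm_cls, g.cls_rep, g.cls_rep]
  · rw [genSecondFundForm_eq, leafIso_cls hh hπN, hΨ, hΨ]
    exact tmap_leafProj_secondFundForm hg hgs hh hhs hπM hπN hC hφ x _ _

theorem isHarmonic_leafMap_iff (hg : IsSemiRiemannian g r p q) (hgs : g.IsStationary)
    (hh : IsSemiRiemannian h ρ p' q') (hhs : h.IsStationary)
    (hπM : Manifold.IsSubmersion 𝓘(ℝ, Eucl m) 𝓘(ℝ, Eucl (p + q)) ∞ g.leafProj)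
    (hπN : Manifold.IsSubmersion 𝓘(ℝ, Eucl n) 𝓘(ℝ, Eucl (p' + q')) ∞ h.leafProj)
    (hC : ContMDiff 𝓘(ℝ, Eucl m) 𝓘(ℝ, Eucl n) 2 φ) (hφ : RadicalPreserving g h φ) :
    IsHarmonic (g.leafMetric (p + q)) (h.leafMetric (p' + q')) (leafMap hφ hC) ↔
      IsGenHarmonic hφ := by
  refine g.leafProj_surjective.forall.trans (forall_congr' fun x => ?_)
  rw [← leafIso_genTensionField hg hgs hh hhs hπM hπN hC hφ x]
  exact map_eq_zero_iff _ (leafIso_bijective hh hπN (φ x)).1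

end LeafMap

end

theorem mainTheorem3 {m n r p q ρ p' q' : ℕ} {M N : Type*}
    [TopologicalSpace M] [T2Space M] [ChartedSpace (Eucl m) M] [IsManifold 𝓘(ℝ, Eucl m) ∞ M]
    [TopologicalSpace N] [T2Space N] [ChartedSpace (Eucl n) N] [IsManifold 𝓘(ℝ, Eucl n) ∞ N]
    -- two stationary semi-Riemannian manifolds
    (g : SymTensor m M) (hg : IsSemiRiemannian g r p q) (hgs : g.IsStationary)
    (h : SymTensor n N) (hh : IsSemiRiemannian h ρ p' q') (hhs : h.IsStationary)
    -- whose radical foliations are simple: the leaf spaces are Hausdorff manifolds, of dimensions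
    -- `m - r = p + q` and `n - ρ = p' + q'`, such that the projections are smooth submersions
    [T2Space g.LeafSpace] [ChartedSpace (Eucl (p + q)) g.LeafSpace]
    [IsManifold 𝓘(ℝ, Eucl (p + q)) ∞ g.LeafSpace]
    (hπM : Manifold.IsSubmersion 𝓘(ℝ, Eucl m) 𝓘(ℝ, Eucl (p + q)) ∞ g.leafProj)
    [T2Space h.LeafSpace] [ChartedSpace (Eucl (p' + q')) h.LeafSpace]
    [IsManifold 𝓘(ℝ, Eucl (p' + q')) ∞ h.LeafSpace]
    (hπN : Manifold.IsSubmersion 𝓘(ℝ, Eucl n) 𝓘(ℝ, Eucl (p' + q')) ∞ h.leafProj)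
    -- a `C²` radical-preserving map
    (φ : M → N) (hC : ContMDiff 𝓘(ℝ, Eucl m) 𝓘(ℝ, Eucl n) 2 φ) (hφ : RadicalPreserving g h φ) :
    -- the identifications `Ψ` are well defined isomorphisms
    (∀ x, (∀ u, g.leafIso (p + q) x (g.cls x u) = tmap m (p + q) g.leafProj x u) ∧
      Function.Bijective (g.leafIso (p + q) x)) ∧
    (∀ y, (∀ u, h.leafIso (p' + q') y (h.cls y u) = tmap n (p' + q') h.leafProj y u) ∧
      Function.Bijective (h.leafIso (p' + q') y)) ∧
    -- the induced metrics on the leaf spaces are well defined, smooth and non-degenerate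
    IsSemiRiemannian (g.leafMetric (p + q)) 0 p q ∧
    (∀ x u v, (g.leafMetric (p + q)).form (g.leafProj x)
      (tmap m (p + q) g.leafProj x u) (tmap m (p + q) g.leafProj x v) = g.form x u v) ∧
    IsSemiRiemannian (h.leafMetric (p' + q')) 0 p' q' ∧
    (∀ y u v, (h.leafMetric (p' + q')).form (h.leafProj y)
      (tmap n (p' + q') h.leafProj y u) (tmap n (p' + q') h.leafProj y v) = h.form y u v) ∧
    -- the induced map is `C²`
    ContMDiff 𝓘(ℝ, Eucl (p + q)) 𝓘(ℝ, Eucl (p' + q')) 2 (leafMap hφ hC) ∧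
    -- under `Ψ`, the generalized tension field of `φ` at `x` is the tension field of the induced
    -- map at `[x]`
    (∀ x, h.leafIso (p' + q') (φ x) (genTensionField hφ x) =
      tensionField (g.leafMetric (p + q)) (h.leafMetric (p' + q')) (leafMap hφ hC)
        (g.leafProj x)) ∧
    (IsHarmonic (g.leafMetric (p + q)) (h.leafMetric (p' + q')) (leafMap hφ hC) ↔
      IsGenHarmonic hφ) := by
  have hlM := isSemiRiemannian_leafMetric hg hgs hπM
  have hlN := isSemiRiemannian_leafMetric hh hhs hπN
  exact ⟨fun x => ⟨leafIso_cls hg hπM x, leafIso_bijective hg hπM x⟩,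
    fun y => ⟨leafIso_cls hh hπN y, leafIso_bijective hh hπN y⟩,
    hlM, leafMetric_form_tmap hg hgs hπM, hlN, leafMetric_form_tmap hh hhs hπN,
    contMDiff_leafMap hπM hπN hC hφ,
    leafIso_genTensionField hg hgs hh hhs hπM hπN hC hφ,
    isHarmonic_leafMap_iff hg hgs hh hhs hπM hπN hC hφ⟩
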